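/- Let $\tau=(\tau_i)_{i\in\mathbb Z}$ be i.i.d. non-negative random variables with $\mathbb E\tau_0<\infty$ and $\operatorname{Var}\tau_0<\infty$, not almost surely equal to a constant. Let $\pi=(\pi_j)_{j\in\mathbb Z}$ be a random probability distribution on $\mathbb Z$ (that is, almost surely $\pi_j\ge 0$ for all $j$ and $\sum_j\pi_j=1$), and let $\Pi=(\pi_{i,j})_{i,j\in\mathbb Z}$ be a random matrix, independent of $\tau$, such that the vectors $(\pi_{i,i+j})_{j\in\mathbb Z}$, $i\in\mathbb Z$, are i.i.d. copies of $\pi$. Assume that the set $K=\{i\in\mathbb Z:\mathbb P(\pi_i>0)>0\}$ is finite with $|K|\ge 2$, and that every subvector of $(\pi_i)_{i\in K}$ is exchangeable. Then the sequence $\tau\Pi=\bigl(\sum_{i}\tau_i\pi_{i,j}\bigr)_{j\in\mathbb Z}$ has the same distribution as $\tau$ if and only if there are $a,\gamma>0$ such that every $\tau_j$ has the Gamma distribution $\Gamma(a,\gamma)$ with shape $a$ and rate $\gamma$, and $(\pi_i)_{i\in K}$ has the symmetric Dirichlet distribution with all $|K|$ parameters equal to $a/|K|$. -/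

import Mathlib

open MeasureTheory ProbabilityTheory

namespace MassExchange

/-- A finite family `X = (X i)` of real random variables is exchangeable: permuting the indices does
not change its joint law. -/
def IsExchangeable {Ω ι : Type*} [MeasurableSpace Ω] (P : Measure Ω) (X : ι → Ω → ℝ) : Prop :=
  ∀ s : Equiv.Perm ι, IdentDistrib (fun ω i => X (s i) ω) (fun ω i => X i ω) P P

section Dirichlet

variable {ι : Type*} [Fintype ι] [DecidableEq ι]

/-- The Dirichlet density with parameters `α`, at a point `x` of the simplex `∑ i, x i = 1`. -/
noncomputable def dirichletPDFReal (α : ι → ℝ) (x : ι → ℝ) : ℝ :=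
  open Classical in
  if ∀ i, 0 < x i then
    Real.Gamma (∑ i, α i) / (∏ i, Real.Gamma (α i)) * ∏ i, x i ^ (α i - 1)
  else 0

/-- The point of the hyperplane `∑ i, x i = 1` whose coordinates other than `i₀` are given by `y`. -/
noncomputable def simplexPoint (i₀ : ι) (y : {i : ι // i ≠ i₀} → ℝ) : ι → ℝ :=
  fun i => if h : i = i₀ then 1 - ∑ j, y j else y ⟨i, h⟩

/-- The Dirichlet distribution with parameters `α`: the coordinates other than `i₀` have the joint
density `dirichletPDFReal α` with respect to Lebesgue measure, and the coordinate `i₀` is one minus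
their sum. -/
noncomputable def dirichletMeasure (i₀ : ι) (α : ι → ℝ) : Measure (ι → ℝ) :=
  ((volume : Measure ({i : ι // i ≠ i₀} → ℝ)).withDensity
    (fun y => ENNReal.ofReal (dirichletPDFReal α (simplexPoint i₀ y)))).map (simplexPoint i₀)

/-- The random vector `X = (X i)` has the Dirichlet distribution with positive parameters `α`.
The coordinate `i₀` that is expressed through the others is immaterial: exchanging two such
coordinates is an affine bijection of determinant `±1`. -/
def IsDirichlet {Ω : Type*} [MeasurableSpace Ω] (P : Measure Ω) (X : ι → Ω → ℝ) (α : ι → ℝ) : Prop :=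
  (∀ i, 0 < α i) ∧ ∃ i₀ : ι, HasLaw (fun ω i => X i ω) (dirichletMeasure i₀ α) P

end Dirichlet

section Exchange

variable {Ω Ω' : Type*} [MeasurableSpace Ω] [MeasurableSpace Ω']

/-- The initial masses are non-negative, independent, identically distributed and integrable. -/
structure CondA1 (P : Measure Ω) (τ : ℤ → Ω → ℝ) : Prop where
  nonneg : ∀ i, ∀ᵐ ω ∂P, 0 ≤ τ i ω
  indep : iIndepFun τ P
  ident : ∀ i, IdentDistrib (τ i) (τ 0) P P
  integrable : ∀ i, Integrable (τ i) P

/-- The initial masses have finite second moments. -/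
def CondA2 (P : Measure Ω) (τ : ℤ → Ω → ℝ) : Prop :=
  ∀ i, MemLp (τ i) 2 P

/-- Translation invariance: `π = (π j)` is a random probability distribution on `ℤ`, and the rows
`(M i (i + j))_j` of the exchange matrix, seen from the agent `i`, are i.i.d. copies of `π`. -/
structure CondB1 (P : Measure Ω) (M : ℤ → ℤ → Ω → ℝ) (P' : Measure Ω') (π : ℤ → Ω' → ℝ) : Prop where
  nonneg : ∀ᵐ ω ∂P', ∀ j, 0 ≤ π j ω
  hasSum_one : ∀ᵐ ω ∂P', HasSum (fun j => π j ω) 1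
  ident : ∀ i, IdentDistrib (fun ω j => M i (i + j) ω) (fun ω j => π j ω) P P'
  indep : iIndepFun (fun (i : ℤ) (ω : Ω) (j : ℤ) => M i (i + j) ω) P

/-- The masses after one exchange: the row vector `τ` times the exchange matrix `M`. -/
noncomputable def exchange (τ : ℤ → Ω → ℝ) (M : ℤ → ℤ → Ω → ℝ) (j : ℤ) (ω : Ω) : ℝ :=
  ∑' i, τ i ω * M i j ω

end Exchange

end MassExchange

namespace MassExchange

/-! Let φ be the Laplace transform of `τ 0` and Φ that of the vector of shares `τ 0 * π k`, `k ∈ K`,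
with independent factors. By independence, for finitely supported θ ≥ 0, the exchanged masses have
joint Laplace transform ∏_i Φ((θ_{i+k})_k) (`integral_exp_neg_exchange`) and the original ones ∏_j
φ(θ_j). Since Laplace transforms determine laws on products of half-lines
(`measure_eq_of_forall_laplace_eq`), invariance means that these products agree.

Necessity. The agreement forces Φ(t) = ∏_k f(t_k) (`eq_prod_of_prod_sources_eq`): plant t on K; each
translated window sees either fewer nonzero entries, where induction applies, or a permutation of t,
so no two errors can compensate. Hence the shares of one agent are i.i.d. Computing the second
moment of one share, weighted by the exponential of the total, in two ways gives A F''F = B F'² for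
the mgf F of a share. Its nondegenerate solutions are Gamma (`exists_eq_gammaMeasure_of_ode`), so `τ
0` is Gamma too. Dividing the shares by their sum recovers π, which must then be Dirichlet
(`exists_gamma_of_scaledLaw_eq_pi`).

Sufficiency. A Gamma mass split by an independent Dirichlet vector with matching parameters gives
independent Gamma shares (`map_smul_gammaMeasure_prod_dirichletMeasure`). Each site collects |K|
independent Γ(a/|K|, γ) shares, whose sum is Γ(a, γ). -/

lemma measurableSet_orthant (ι : Type*) [Countable ι] :
    MeasurableSet {x : ι → ℝ | ∀ i, 0 ≤ x i} := by
  rw [Set.ofPred_forall]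
  exact MeasurableSet.iInter fun i => measurableSet_le measurable_const (measurable_pi_apply i)

/-! ### Laplace transforms determine measures on products of half-lines. -/

section Laplace

variable {ι : Type*} [Fintype ι]

/-- The Laplace transform of a measure on `ι → ℝ`. -/
noncomputable def laplace (ν : Measure (ι → ℝ)) (t : ι → ℝ) : ℝ :=
  ∫ x, Real.exp (-∑ i, t i * x i) ∂ν

lemma measurable_exp_neg_sum (t : ι → ℝ) :
    Measurable fun x : ι → ℝ => Real.exp (-∑ i, t i * x i) := by
  fun_prop

/-- The function `x ↦ exp (-⟨t, x⟩)` on the positive orthant. -/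
noncomputable def expNegBCF (t : ι → NNReal) : BoundedContinuousFunction (ι → NNReal) ℝ :=
  BoundedContinuousFunction.ofNormedAddCommGroup
    (fun x => Real.exp (-∑ i, (t i : ℝ) * (x i : ℝ))) (by fun_prop) 1 (fun x => by
      rw [Real.norm_eq_abs, Real.abs_exp, Real.exp_le_one_iff, neg_nonpos]
      positivity)

@[simp]
lemma expNegBCF_apply (t : ι → NNReal) (x : ι → NNReal) :
    expNegBCF t x = Real.exp (-∑ i, (t i : ℝ) * (x i : ℝ)) := rfl

lemma expNegBCF_add (s t : ι → NNReal) : expNegBCF (s + t) = expNegBCF s * expNegBCF t := by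
  ext x
  simp only [expNegBCF_apply, BoundedContinuousFunction.coe_mul, Pi.mul_apply, ← Real.exp_add,
    Pi.add_apply, NNReal.coe_add, add_mul, Finset.sum_add_distrib]
  congr 1
  ring

lemma expNegBCF_zero : expNegBCF (0 : ι → NNReal) = 1 := by
  ext x
  simp

/-- The subalgebra spanned by the functions `x ↦ exp (-⟨t, x⟩)`. -/
noncomputable def expNegSubalgebra (ι : Type*) [Fintype ι] :
    StarSubalgebra ℝ (BoundedContinuousFunction (ι → NNReal) ℝ) where
  toSubalgebra := Algebra.adjoin ℝ (Set.range expNegBCF)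
  star_mem' := by
    intro a ha
    have : star a = a := by ext x; simp
    rwa [this]

/-- The exponentials are closed under products and contain 1, so the algebra they generate is their
linear span, and integration is linear. -/
lemma integral_eq_of_mem_expNegSubalgebra {P Q : Measure (ι → NNReal)} [IsFiniteMeasure P]
    [IsFiniteMeasure Q] (h : ∀ t, ∫ x, expNegBCF t x ∂P = ∫ x, expNegBCF t x ∂Q)
    (g : BoundedContinuousFunction (ι → NNReal) ℝ) (hg : g ∈ expNegSubalgebra ι) :
    ∫ x, g x ∂P = ∫ x, g x ∂Q := by
  have hg' : g ∈ Subalgebra.toSubmodule (Algebra.adjoin ℝ (Set.range (expNegBCF (ι := ι)))) := hg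
  rw [Algebra.adjoin_eq_span] at hg'
  have hcl : (Submonoid.closure (Set.range (expNegBCF (ι := ι))) : Set _) ⊆
      Set.range (expNegBCF (ι := ι)) := by
    intro f hf
    induction hf using Submonoid.closure_induction with
    | mem x hx => exact hx
    | one => exact ⟨0, expNegBCF_zero⟩
    | mul x y _ _ hx hy =>
      obtain ⟨s, rfl⟩ := hx
      obtain ⟨t, rfl⟩ := hy
      exact ⟨s + t, expNegBCF_add s t⟩
  induction hg' using Submodule.span_induction with
  | mem x hx => obtain ⟨t, rfl⟩ := hcl hx; exact h t
  | zero => simp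
  | add x y _ _ hx hy =>
    simp only [BoundedContinuousFunction.coe_add, Pi.add_apply]
    rw [integral_add (x.integrable P) (y.integrable P), integral_add (x.integrable Q)
      (y.integrable Q), hx, hy]
    all_goals
      simp only [expNegSubalgebra] at *
      rw [← StarSubalgebra.mem_toSubalgebra, ← Subalgebra.mem_toSubmodule, Algebra.adjoin_eq_span]
      assumption
  | smul a x _ hx =>
    simp only [BoundedContinuousFunction.coe_smul, integral_const_mul, smul_eq_mul]
    rw [hx]
    rw [← StarSubalgebra.mem_toSubalgebra, ← Subalgebra.mem_toSubmodule, expNegSubalgebra,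
      Algebra.adjoin_eq_span]
    assumption

/-- A point-separating algebra of bounded continuous functions determines finite measures on a
Polish space. Working over `NNReal` is what makes the exponentials bounded. -/
lemma measure_eq_of_integral_expNegBCF_eq {P Q : Measure (ι → NNReal)} [IsFiniteMeasure P]
    [IsFiniteMeasure Q] (h : ∀ t, ∫ x, expNegBCF t x ∂P = ∫ x, expNegBCF t x ∂Q) : P = Q := by
  classical
  refine ext_of_forall_mem_subalgebra_integral_eq_of_polish (𝕜 := ℝ) (A := expNegSubalgebra ι) ?_
    (integral_eq_of_mem_expNegSubalgebra h)
  intro x y hxy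
  obtain ⟨i, hi⟩ := Function.ne_iff.mp hxy
  refine ⟨expNegBCF (Pi.single i 1), ⟨_, ⟨expNegBCF (Pi.single i 1),
    Algebra.subset_adjoin ⟨_, rfl⟩, rfl⟩, rfl⟩, ?_⟩
  simp [Pi.single_apply, apply_ite NNReal.toReal, hi]

/-- The Laplace transform determines a finite measure on the positive orthant. -/
theorem measure_eq_of_laplace_eq {P Q : Measure (ι → ℝ)} [IsFiniteMeasure P] [IsFiniteMeasure Q]
    (hP : ∀ᵐ x ∂P, ∀ i, 0 ≤ x i) (hQ : ∀ᵐ x ∂Q, ∀ i, 0 ≤ x i)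
    (h : ∀ t : ι → ℝ, (∀ i, 0 ≤ t i) → laplace P t = laplace Q t) : P = Q := by
  let r : (ι → ℝ) → (ι → NNReal) := fun x i => (x i).toNNReal
  let c : (ι → NNReal) → (ι → ℝ) := fun x i => x i
  have hr : Measurable r := by fun_prop
  have hc : Measurable c := by fun_prop
  -- Truncating at zero loses nothing for a measure carried by the orthant.
  have key : ∀ κ : Measure (ι → ℝ), (∀ᵐ x ∂κ, ∀ i, 0 ≤ x i) → (κ.map r).map c = κ := by
    intro κ hR
    rw [Measure.map_map hc hr]
    conv_rhs => rw [← Measure.map_id (μ := κ)]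
    refine Measure.map_congr ?_
    filter_upwards [hR] with x hx
    ext i
    simp [r, c, hx i]
  have key2 : ∀ κ : Measure (ι → ℝ), (∀ᵐ x ∂κ, ∀ i, 0 ≤ x i) → ∀ t : ι → NNReal,
      ∫ x, expNegBCF t x ∂(κ.map r) = laplace κ (fun i => t i) := by
    intro κ hR t
    rw [integral_map hr.aemeasurable
      (expNegBCF t).continuous.measurable.aestronglyMeasurable]
    refine integral_congr_ae ?_
    filter_upwards [hR] with x hx
    simp only [expNegBCF_apply, r]
    simp [hx]
  rw [← key P hP, ← key Q hQ]
  congr 1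
  refine measure_eq_of_integral_expNegBCF_eq fun t => ?_
  rw [key2 P hP, key2 Q hQ]
  exact h _ (fun i => (t i).2)

/-- The Laplace transform determines a finite measure on the half-line. -/
theorem measure_eq_of_integral_exp_neg_eq {P Q : Measure ℝ} [IsFiniteMeasure P] [IsFiniteMeasure Q]
    (hP : ∀ᵐ x ∂P, 0 ≤ x) (hQ : ∀ᵐ x ∂Q, 0 ≤ x)
    (h : ∀ t : ℝ, 0 ≤ t → ∫ x, Real.exp (-(t * x)) ∂P = ∫ x, Real.exp (-(t * x)) ∂Q) : P = Q := by
  let e := MeasurableEquiv.funUnique Unit ℝ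
  have he : Measurable e.symm := e.symm.measurable
  refine e.symm.map_measurableEquiv_injective ?_
  refine measure_eq_of_laplace_eq ?_ ?_ ?_
  · rw [ae_map_iff he.aemeasurable (measurableSet_orthant _)]
    filter_upwards [hP] with x hx i using hx
  · rw [ae_map_iff he.aemeasurable (measurableSet_orthant _)]
    filter_upwards [hQ] with x hx i using hx
  · intro t ht
    rw [laplace, laplace, integral_map_equiv, integral_map_equiv]
    simpa [e] using h (t ()) (ht ())

end Laplace

/-- A finite measure on a product of half-lines is determined by the Laplace transforms of its
finite-dimensional marginals. -/
theorem measure_eq_of_forall_laplace_eq {ι : Type*} {P Q : Measure (ι → ℝ)} [IsFiniteMeasure P]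
    [IsFiniteMeasure Q] (hP : ∀ i, ∀ᵐ x ∂P, 0 ≤ x i) (hQ : ∀ i, ∀ᵐ x ∂Q, 0 ≤ x i)
    (h : ∀ (J : Finset ι) (t : ι → ℝ), (∀ i, 0 ≤ t i) →
      ∫ x, Real.exp (-∑ i ∈ J, t i * x i) ∂P = ∫ x, Real.exp (-∑ i ∈ J, t i * x i) ∂Q) : P = Q := by
  have hJ : ∀ J : Finset ι, P.map J.restrict = Q.map J.restrict := by
    intro J
    have hm : Measurable (J.restrict : (ι → ℝ) → (J → ℝ)) := by fun_prop
    refine measure_eq_of_laplace_eq ?_ ?_ ?_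
    · rw [ae_map_iff hm.aemeasurable (measurableSet_orthant _)]
      exact ae_all_iff.2 fun i => hP i
    · rw [ae_map_iff hm.aemeasurable (measurableSet_orthant _)]
      exact ae_all_iff.2 fun i => hQ i
    · intro t ht
      classical
      have hl : ∀ κ : Measure (ι → ℝ), laplace (κ.map J.restrict) t =
          ∫ x, Real.exp (-∑ i ∈ J, (if hi : i ∈ J then t ⟨i, hi⟩ else 0) * x i) ∂κ := by
        intro κ
        rw [laplace, integral_map hm.aemeasurable
          (measurable_exp_neg_sum t).aestronglyMeasurable]
        refine integral_congr_ae (ae_of_all _ fun x => ?_)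
        simp only
        rw [← Finset.sum_coe_sort J]
        simp
      rw [hl, hl]
      refine h J _ fun i => ?_
      split_ifs
      exacts [ht _, le_rfl]
  have h1 : IsProjectiveLimit P (fun J => P.map J.restrict) := fun J => rfl
  have h2 : IsProjectiveLimit Q (fun J => P.map J.restrict) := fun J => (hJ J).symm
  exact h1.unique h2

/-! ### The Laplace transform of the Gamma distribution. -/

section Gamma

lemma gammaMeasure_ae_nonneg (a r : ℝ) : ∀ᵐ x ∂(gammaMeasure a r), 0 ≤ x := by
  rw [gammaMeasure, ae_withDensity_iff (f := gammaPDF a r)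
    (measurable_gammaPDFReal a r).ennreal_ofReal]
  refine ae_of_all _ fun x hx => ?_
  by_contra hx0
  exact hx (gammaPDF_of_neg (not_le.1 hx0))

lemma gammaMeasure_ae_pos (a r : ℝ) : ∀ᵐ x ∂(gammaMeasure a r), 0 < x := by
  have h0 : ∀ᵐ x ∂(gammaMeasure a r), x ≠ 0 := by
    refine (withDensity_absolutelyContinuous _ _).ae_le ?_
    exact Measure.ae_ne volume 0
  filter_upwards [gammaMeasure_ae_nonneg a r, h0] with x h1 h2
  exact lt_of_le_of_ne h1 h2.symm

/-- The Laplace transform of a Gamma distribution. -/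
theorem integral_exp_neg_gammaMeasure {a r : ℝ} (ha : 0 < a) (hr : 0 < r) {s : ℝ} (hs : 0 ≤ s) :
    ∫ x, Real.exp (-(s * x)) ∂(gammaMeasure a r) = (r / (r + s)) ^ a := by
  have hrs : 0 < r + s := by linarith
  have h1 : ∫ x, Real.exp (-(s * x)) ∂(gammaMeasure a r) =
      ∫ x, gammaPDFReal a r x * Real.exp (-(s * x)) := by
    rw [gammaMeasure, integral_withDensity_eq_integral_toReal_smul
      (f := gammaPDF a r) (measurable_gammaPDFReal a r).ennreal_ofReal
      (ae_of_all _ fun x => by simp [gammaPDF])]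
    simp [gammaPDF, ENNReal.toReal_ofReal (gammaPDFReal_nonneg ha hr _)]
  -- Exponential tilting turns the rate `r` into `r + s`, up to a constant.
  have h2 : ∀ x, gammaPDFReal a r x * Real.exp (-(s * x)) =
      (r / (r + s)) ^ a * gammaPDFReal a (r + s) x := by
    intro x
    unfold gammaPDFReal
    split_ifs
    · rw [Real.div_rpow hr.le hrs.le]
      have : Real.exp (-((r + s) * x)) = Real.exp (-(r * x)) * Real.exp (-(s * x)) := by
        rw [← Real.exp_add]; ring_nf
      rw [this]
      have := (Real.rpow_pos_of_pos hrs a).ne'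
      field_simp
    · simp
  have h3 : ∫ x, gammaPDFReal a (r + s) x = 1 := by
    rw [integral_eq_lintegral_of_nonneg_ae (ae_of_all _ (gammaPDFReal_nonneg ha hrs))
      (by fun_prop)]
    have := lintegral_gammaPDF_eq_one ha hrs
    simp only [gammaPDF] at this
    simp [this]
  simp_rw [h1, h2, integral_const_mul, h3, mul_one]

end Gamma

/-! ### Product densities and the pointwise Gamma–Dirichlet identity. -/

section GammaDirichlet

variable {ι : Type*} [Fintype ι]

/-- A product of absolutely continuous measures has the product density. -/
lemma pi_withDensity_ofReal {g : ι → ℝ → ℝ} (hg : ∀ i x, 0 ≤ g i x)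
    (hi : ∀ i, Integrable (g i)) :
    Measure.pi (fun i => (volume : Measure ℝ).withDensity fun x => ENNReal.ofReal (g i x)) =
      (volume : Measure (ι → ℝ)).withDensity fun x => ENNReal.ofReal (∏ i, g i (x i)) := by
  classical
  have hfin : ∀ i, IsFiniteMeasure
      ((volume : Measure ℝ).withDensity fun x => ENNReal.ofReal (g i x)) := fun i =>
    isFiniteMeasure_withDensity_ofReal (hi i).hasFiniteIntegral
  refine Measure.pi_eq fun s hs => ?_
  have hI : ∀ i, Integrable ((s i).indicator (g i)) := fun i => (hi i).indicator (hs i)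
  have h0 : ∀ i x, 0 ≤ (s i).indicator (g i) x := fun i x =>
    Set.indicator_nonneg (fun y _ => hg i y) x
  have hR : ∀ i, ((volume : Measure ℝ).withDensity fun x => ENNReal.ofReal (g i x)) (s i) =
      ENNReal.ofReal (∫ x, (s i).indicator (g i) x) := by
    intro i
    rw [withDensity_apply _ (hs i), ← lintegral_indicator (hs i),
      ofReal_integral_eq_lintegral_ofReal (hI i) (ae_of_all _ (h0 i))]
    refine lintegral_congr fun x => ?_
    by_cases hx : x ∈ s i <;> simp [hx]
  rw [withDensity_apply _ (MeasurableSet.univ_pi hs),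
    ← lintegral_indicator (MeasurableSet.univ_pi hs)]
  simp_rw [hR]
  rw [← ENNReal.ofReal_prod_of_nonneg (fun i _ => integral_nonneg (h0 i)),
    ← integral_fintype_prod_volume_eq_prod (fun i => (s i).indicator (g i)),
    ofReal_integral_eq_lintegral_ofReal (by exact Integrable.fintype_prod hI)
      (ae_of_all _ fun x => Finset.prod_nonneg fun i _ => h0 i _)]
  refine lintegral_congr fun x => ?_
  by_cases hx : x ∈ Set.univ.pi s
  · rw [Set.indicator_of_mem hx]
    congr 1
    refine Finset.prod_congr rfl fun i _ => ?_
    rw [Set.indicator_of_mem (hx i trivial)]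
  · rw [Set.indicator_of_notMem hx]
    simp only [Set.mem_univ_pi, not_forall] at hx
    obtain ⟨i, hx⟩ := hx
    rw [Finset.prod_eq_zero (Finset.mem_univ i), ENNReal.ofReal_zero]
    exact Set.indicator_of_notMem hx _

/-- The Gamma density, set to zero at the origin. -/
noncomputable def gammaPos (a r x : ℝ) : ℝ := (Set.Ioi 0).indicator (gammaPDFReal a r) x

lemma gammaPos_of_pos {a r x : ℝ} (hx : 0 < x) :
    gammaPos a r x = r ^ a / Real.Gamma a * x ^ (a - 1) * Real.exp (-(r * x)) := by
  simp [gammaPos, gammaPDFReal, hx, hx.le]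

lemma gammaPos_of_nonpos {a r x : ℝ} (hx : x ≤ 0) : gammaPos a r x = 0 := by
  simp [gammaPos, hx]

lemma measurable_gammaPos (a r : ℝ) : Measurable (gammaPos a r) :=
  (measurable_gammaPDFReal a r).indicator measurableSet_Ioi

lemma gammaPos_nonneg {a r : ℝ} (ha : 0 < a) (hr : 0 < r) (x : ℝ) : 0 ≤ gammaPos a r x :=
  Set.indicator_nonneg (fun y _ => gammaPDFReal_nonneg ha hr y) x

/-- Only the value at the null point 0 differs. With it, products of Gamma densities vanish off the
open orthant, as `dirichletPDFReal` does, so that `gamma_mul_dirichletPDFReal` can hold pointwise.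
-/
lemma gammaMeasure_eq_withDensity (a r : ℝ) :
    gammaMeasure a r = volume.withDensity fun x => ENNReal.ofReal (gammaPos a r x) := by
  refine withDensity_congr_ae ?_
  filter_upwards [Measure.ae_ne volume (0 : ℝ)] with x hx
  rcases lt_or_gt_of_ne hx with h | h
  · rw [gammaPDF_of_neg h, gammaPos_of_nonpos h.le, ENNReal.ofReal_zero]
  · rw [gammaPDF_of_nonneg h.le, gammaPos_of_pos h]

lemma integrable_gammaPos {a r : ℝ} (ha : 0 < a) (hr : 0 < r) : Integrable (gammaPos a r) := by
  refine ⟨(measurable_gammaPos a r).aestronglyMeasurable, ?_⟩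
  rw [hasFiniteIntegral_iff_ofReal (ae_of_all _ (gammaPos_nonneg ha hr))]
  have := isProbabilityMeasure_gammaMeasure ha hr
  have h := measure_lt_top (gammaMeasure a r) Set.univ
  rwa [gammaMeasure_eq_withDensity, withDensity_apply _ MeasurableSet.univ,
    Measure.restrict_univ] at h

lemma measurable_dirichletPDFReal (α : ι → ℝ) : Measurable (dirichletPDFReal α) := by
  unfold dirichletPDFReal
  refine Measurable.ite ?_ ?_ measurable_const
  · rw [Set.ofPred_forall]
    exact MeasurableSet.iInter fun i => measurableSet_lt measurable_const (measurable_pi_apply i)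
  · fun_prop

/-- This is the change of variables to total s and proportions, with Jacobian factor s^{-(n-1)}.
With A = ∑ α i, the powers s^{A-1}, s^{-(n-1)} and s^{-(A-n)} cancel, and so does Γ(A). -/
lemma gamma_mul_dirichletPDFReal [Nonempty ι] {α : ι → ℝ} (hα : ∀ i, 0 < α i) {r : ℝ} (hr : 0 < r)
    (x : ι → ℝ) (hs : 0 < ∑ i, x i) :
    gammaPos (∑ i, α i) r (∑ i, x i) * (((∑ i, x i)⁻¹) ^ (Fintype.card ι - 1) *
      dirichletPDFReal α ((∑ i, x i)⁻¹ • x)) = ∏ i, gammaPos (α i) r (x i) := by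
  set s := ∑ i, x i with hsdef
  by_cases hx : ∀ i, 0 < x i
  · have hx' : ∀ i, 0 < (s⁻¹ • x) i := fun i => by
      simp only [Pi.smul_apply, smul_eq_mul]
      exact mul_pos (inv_pos.2 hs) (hx i)
    rw [gammaPos_of_pos hs, dirichletPDFReal, if_pos hx']
    simp_rw [fun i => gammaPos_of_pos (a := α i) (r := r) (hx i)]
    rw [Finset.prod_mul_distrib, Finset.prod_mul_distrib, Finset.prod_div_distrib,
      ← Real.exp_sum, Finset.sum_neg_distrib, ← Finset.mul_sum, ← hsdef,
      ← Real.rpow_sum_of_pos hr]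
    have hA : 0 < ∑ i, α i := Finset.sum_pos (fun i _ => hα i) Finset.univ_nonempty
    have hG := (Real.Gamma_pos_of_pos hA).ne'
    have h1 : ∏ i, (s⁻¹ • x) i ^ (α i - 1) =
        s⁻¹ ^ (∑ i, α i - Fintype.card ι) * ∏ i, x i ^ (α i - 1) := by
      have : ∑ i, α i - (Fintype.card ι : ℝ) = ∑ i, (α i - 1) := by simp
      rw [this, Real.rpow_sum_of_pos (inv_pos.2 hs), ← Finset.prod_mul_distrib]
      refine Finset.prod_congr rfl fun i _ => ?_
      rw [Pi.smul_apply, smul_eq_mul, Real.mul_rpow (inv_pos.2 hs).le (hx i).le]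
    rw [h1]
    have hcard : 1 ≤ Fintype.card ι := Fintype.card_pos
    have h2 : s ^ (∑ i, α i - 1) * (s⁻¹ ^ (Fintype.card ι - 1) *
        s⁻¹ ^ (∑ i, α i - Fintype.card ι)) = 1 := by
      rw [← Real.rpow_natCast, Nat.cast_sub hcard, ← Real.rpow_add (inv_pos.2 hs),
        Real.inv_rpow hs.le]
      have : ((Fintype.card ι : ℝ) - (1 : ℕ) + (∑ i, α i - Fintype.card ι)) = ∑ i, α i - 1 := by
        push_cast; ring
      rw [this]
      exact mul_inv_cancel₀ (Real.rpow_pos_of_pos hs _).ne'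
    calc _ = (s ^ (∑ i, α i - 1) * (s⁻¹ ^ (Fintype.card ι - 1) *
        s⁻¹ ^ (∑ i, α i - Fintype.card ι))) * (Real.Gamma (∑ i, α i) / Real.Gamma (∑ i, α i)) *
        (r ^ (∑ i, α i) / (∏ i, Real.Gamma (α i)) * (∏ i, x i ^ (α i - 1)) *
          Real.exp (-(r * s))) := by ring
      _ = _ := by rw [h2, div_self hG]; ring
  · have hx' : ¬ ∀ i, 0 < (s⁻¹ • x) i := by
      intro h
      refine hx fun i => ?_
      have := h i
      simp only [Pi.smul_apply, smul_eq_mul] at this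
      exact (pos_iff_pos_of_mul_pos this).1 (inv_pos.2 hs)
    rw [dirichletPDFReal, if_neg hx', mul_zero, mul_zero]
    push Not at hx
    obtain ⟨i, hi⟩ := hx
    exact (Finset.prod_eq_zero (Finset.mem_univ i) (gammaPos_of_nonpos hi)).symm

lemma measurable_smul_pi : Measurable fun p : ℝ × (ι → ℝ) => p.1 • p.2 := by fun_prop

end GammaDirichlet

/-! ### Integration along the simplex, and splitting a Gamma mass. -/

section ExtendPoint

variable {ι : Type*} [DecidableEq ι]

/-- The point whose coordinates other than `i₀` are given by `u`, and the coordinate `i₀` by `v`. -/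
def extendPoint (i₀ : ι) (u : {i : ι // i ≠ i₀} → ℝ) (v : ℝ) : ι → ℝ :=
  fun i => if h : i = i₀ then v else u ⟨i, h⟩

lemma measurable_extendPoint (i₀ : ι) :
    Measurable fun p : ({i : ι // i ≠ i₀} → ℝ) × ℝ => extendPoint i₀ p.1 p.2 := by
  refine measurable_pi_iff.2 fun i => ?_
  unfold extendPoint
  by_cases h : i = i₀
  · simp only [h, dite_true]; fun_prop
  · simp only [h, dite_false]; fun_prop

lemma smul_extendPoint (i₀ : ι) (u : {i : ι // i ≠ i₀} → ℝ) (v c : ℝ) :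
    c • extendPoint i₀ u v = extendPoint i₀ (c • u) (c * v) := by
  ext i
  by_cases h : i = i₀ <;> simp [extendPoint, h]

variable [Fintype ι]

lemma simplexPoint_eq_extendPoint (i₀ : ι) (y : {i : ι // i ≠ i₀} → ℝ) :
    simplexPoint i₀ y = extendPoint i₀ y (1 - ∑ j, y j) := rfl

lemma measurable_simplexPoint (i₀ : ι) : Measurable (simplexPoint i₀) := by
  have : simplexPoint i₀ = fun y => extendPoint i₀ y (1 - ∑ j, y j) := by
    ext y; rw [simplexPoint_eq_extendPoint]
  rw [this]
  exact (measurable_extendPoint i₀).comp (measurable_id.prodMk (by fun_prop))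

lemma sum_extendPoint (i₀ : ι) (u : {i : ι // i ≠ i₀} → ℝ) (v : ℝ) :
    ∑ i, extendPoint i₀ u v i = (∑ j, u j) + v := by
  rw [← Finset.sum_erase_add _ _ (Finset.mem_univ i₀)]
  congr 1
  · rw [Finset.sum_subtype (p := fun i => i ≠ i₀) _ (by simp)]
    refine Finset.sum_congr rfl fun i _ => ?_
    simp [extendPoint, i.2]
  · simp [extendPoint]

/-- Tonelli, once the single coordinate `i₀` is split off. -/
lemma lintegral_extendPoint (i₀ : ι) {f : (ι → ℝ) → ENNReal} (hf : Measurable f) :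
    ∫⁻ x, f x = ∫⁻ u : {i : ι // i ≠ i₀} → ℝ, ∫⁻ v : ℝ, f (extendPoint i₀ u v) := by
  let p : ι → Prop := fun i => i ≠ i₀
  let : Unique {i // ¬ p i} := ⟨⟨⟨i₀, by simp [p]⟩⟩, fun i => Subtype.ext (not_not.1 i.2)⟩
  have h1 := (volume_preserving_piEquivPiSubtypeProd (fun _ : ι => ℝ) p).symm
  have h2 : MeasurePreserving (Prod.map id (MeasurableEquiv.funUnique {i // ¬ p i} ℝ).symm)
      (volume : Measure (({i // p i} → ℝ) × ℝ)) volume :=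
    (MeasurePreserving.id volume).prod
      (by convert (volume_preserving_funUnique {i // ¬ p i} ℝ).symm)
  rw [← (h1.comp h2).lintegral_comp hf]
  have hm : Measurable ((MeasurableEquiv.piEquivPiSubtypeProd (fun _ : ι => ℝ) p).symm ∘
    Prod.map id (MeasurableEquiv.funUnique {i // ¬ p i} ℝ).symm) := (h1.comp h2).measurable
  rw [Measure.volume_eq_prod, lintegral_prod _ (by exact (hf.comp hm).aemeasurable)]
  refine lintegral_congr fun u => lintegral_congr fun v => ?_
  congr 1
  ext i
  by_cases h : i = i₀
  · simp [extendPoint, h, p, MeasurableEquiv.piEquivPiSubtypeProd, Equiv.piEquivPiSubtypeProd]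
  · simp [extendPoint, h, p, MeasurableEquiv.piEquivPiSubtypeProd, Equiv.piEquivPiSubtypeProd]

instance sFinite_dirichletMeasure (i₀ : ι) (α : ι → ℝ) : SFinite (dirichletMeasure i₀ α) := by
  unfold dirichletMeasure
  infer_instance

lemma lintegral_dirichletMeasure_smul (i₀ : ι) (α : ι → ℝ) {f : (ι → ℝ) → ENNReal}
    (hf : Measurable f) {s : ℝ} (hs : 0 < s) :
    ∫⁻ x, f (s • x) ∂(dirichletMeasure i₀ α) =
      ∫⁻ u : {i : ι // i ≠ i₀} → ℝ, ENNReal.ofReal (s⁻¹ ^ (Fintype.card ι - 1) *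
        dirichletPDFReal α (s⁻¹ • extendPoint i₀ u (s - ∑ j, u j))) *
          f (extendPoint i₀ u (s - ∑ j, u j)) := by
  have hd : Measurable fun y : {i : ι // i ≠ i₀} → ℝ =>
      ENNReal.ofReal (dirichletPDFReal α (simplexPoint i₀ y)) :=
    ((measurable_dirichletPDFReal α).comp (measurable_simplexPoint i₀)).ennreal_ofReal
  have hfs : Measurable fun x => f (s • x) := hf.comp (measurable_const_smul s)
  rw [dirichletMeasure, lintegral_map hfs (measurable_simplexPoint i₀),
    lintegral_withDensity_eq_lintegral_mul _ hd (by exact hfs.comp (measurable_simplexPoint i₀))]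
  have hmap := Measure.map_addHaar_smul (volume : Measure ({i : ι // i ≠ i₀} → ℝ)) (r := s⁻¹)
    (inv_pos.2 hs).ne'
  have hcard : Module.finrank ℝ ({i : ι // i ≠ i₀} → ℝ) = Fintype.card ι - 1 := by
    simp [Fintype.card_subtype_compl]
  rw [hcard] at hmap
  have hpow : 0 < s⁻¹ ^ (Fintype.card ι - 1) := pow_pos (inv_pos.2 hs) _
  -- Volume is written as a multiple of its own image under scaling by `s⁻¹`, so that the
  -- substitution u = s • y becomes an integral against a pushforward.
  have hvol : (volume : Measure ({i : ι // i ≠ i₀} → ℝ)) =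
      ENNReal.ofReal (s⁻¹ ^ (Fintype.card ι - 1)) •
        (volume : Measure ({i : ι // i ≠ i₀} → ℝ)).map (s⁻¹ • ·) := by
    rw [hmap, smul_smul, ← ENNReal.ofReal_mul hpow.le, abs_of_pos (inv_pos.2 hpow),
      mul_inv_cancel₀ hpow.ne', ENNReal.ofReal_one, one_smul]
  conv_lhs => rw [hvol]
  rw [lintegral_smul_measure, lintegral_map (by
    exact hd.mul (hfs.comp (measurable_simplexPoint i₀))) (measurable_const_smul _), smul_eq_mul,
    ← lintegral_const_mul]
  · refine lintegral_congr fun u => ?_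
    have hp : simplexPoint i₀ (s⁻¹ • u) = s⁻¹ • extendPoint i₀ u (s - ∑ j, u j) := by
      rw [smul_extendPoint, simplexPoint_eq_extendPoint]
      congr 1
      simp only [Pi.smul_apply, smul_eq_mul, ← Finset.mul_sum]
      field_simp
    simp only [Pi.mul_apply, hp, smul_smul, mul_inv_cancel₀ hs.ne', one_smul]
    rw [ENNReal.ofReal_mul hpow.le, mul_assoc]
  · exact (hd.mul (hfs.comp (measurable_simplexPoint i₀))).comp (measurable_const_smul _)

/-- A Gamma variable times an independent Dirichlet vector is a vector of independent Gamma
variables. -/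
theorem map_smul_gammaMeasure_prod_dirichletMeasure (i₀ : ι) {α : ι → ℝ} (hα : ∀ i, 0 < α i)
    {r : ℝ} (hr : 0 < r) :
    ((gammaMeasure (∑ i, α i) r).prod (dirichletMeasure i₀ α)).map (fun p => p.1 • p.2) =
      Measure.pi fun i => gammaMeasure (α i) r := by
  have : Nonempty ι := ⟨i₀⟩
  have hA : 0 < ∑ i, α i := Finset.sum_pos (fun i _ => hα i) Finset.univ_nonempty
  simp_rw [gammaMeasure_eq_withDensity]
  rw [pi_withDensity_ofReal (fun i => gammaPos_nonneg (hα i) hr)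
    (fun i => integrable_gammaPos (hα i) hr)]
  have hp : Measurable fun x : ι → ℝ => ENNReal.ofReal (∏ i, gammaPos (α i) r (x i)) :=
    (Finset.measurable_fun_prod _ fun i _ =>
      (measurable_gammaPos _ _).comp (measurable_pi_apply i)).ennreal_ofReal
  refine Measure.ext_of_lintegral _ fun f hf => ?_
  rw [lintegral_map hf measurable_smul_pi,
    lintegral_prod _ (by exact (hf.comp measurable_smul_pi).aemeasurable),
    lintegral_withDensity_eq_lintegral_mul _ hp hf, lintegral_extendPoint i₀ (hp.mul hf),
    lintegral_withDensity_eq_lintegral_mul _ (measurable_gammaPos _ _).ennreal_ofReal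
      (by exact (hf.comp measurable_smul_pi).lintegral_prod_right')]
  have hE : Measurable fun q : ℝ × ({i : ι // i ≠ i₀} → ℝ) =>
      extendPoint i₀ q.2 (q.1 - ∑ j, q.2 j) :=
    (measurable_extendPoint i₀).comp (measurable_snd.prodMk (by fun_prop))
  have step : ∀ s : ℝ, ((fun x => ENNReal.ofReal (gammaPos (∑ i, α i) r x)) *
      fun x => ∫⁻ y, f (x • y) ∂(dirichletMeasure i₀ α) : ℝ → ENNReal) s =
      ∫⁻ u : {i : ι // i ≠ i₀} → ℝ, ((fun x : ι → ℝ =>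
        ENNReal.ofReal (∏ i, gammaPos (α i) r (x i))) * f)
          (extendPoint i₀ u (s - ∑ j, u j)) := by
    intro s
    simp only [Pi.mul_apply]
    rcases le_or_gt s 0 with hs | hs
    -- A point whose coordinates have a nonpositive sum has a nonpositive coordinate, so both sides
    -- vanish.
    · rw [gammaPos_of_nonpos hs, ENNReal.ofReal_zero, zero_mul]
      symm
      refine lintegral_eq_zero_of_ae_eq_zero (ae_of_all _ fun u => ?_)
      have hsum := sum_extendPoint i₀ u (s - ∑ j, u j)
      have : ∃ i, extendPoint i₀ u (s - ∑ j, u j) i ≤ 0 := by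
        by_contra! hcon
        have := Finset.sum_pos (fun i _ => hcon i) (Finset.univ_nonempty (α := ι))
        linarith
      obtain ⟨i, hi⟩ := this
      simp only [Pi.zero_apply]
      rw [Finset.prod_eq_zero (Finset.mem_univ i) (gammaPos_of_nonpos hi), ENNReal.ofReal_zero,
        zero_mul]
    · rw [lintegral_dirichletMeasure_smul i₀ α hf hs, ← lintegral_const_mul]
      · refine lintegral_congr fun u => ?_
        have hsum : ∑ i, extendPoint i₀ u (s - ∑ j, u j) i = s := by
          rw [sum_extendPoint]; ring
        rw [← mul_assoc, ← ENNReal.ofReal_mul (gammaPos_nonneg hA hr s),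
          ← gamma_mul_dirichletPDFReal hα hr _ (hsum.symm ▸ hs), hsum]
      · have hEs := hE.comp (measurable_const (a := s) |>.prodMk measurable_id)
        refine Measurable.mul (Measurable.ennreal_ofReal (measurable_const.mul ?_)) (hf.comp hEs)
        exact (measurable_dirichletPDFReal α).comp (hEs.const_smul s⁻¹)
  -- After the swap, for fixed `u`, translating the total by `∑ j, u j` makes the last coordinate
  -- the integration variable.
  calc _ = ∫⁻ s : ℝ, ∫⁻ u : {i : ι // i ≠ i₀} → ℝ, ((fun x : ι → ℝ =>
        ENNReal.ofReal (∏ i, gammaPos (α i) r (x i))) * f)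
          (extendPoint i₀ u (s - ∑ j, u j)) := lintegral_congr step
    _ = ∫⁻ u : {i : ι // i ≠ i₀} → ℝ, ∫⁻ s : ℝ, ((fun x : ι → ℝ =>
        ENNReal.ofReal (∏ i, gammaPos (α i) r (x i))) * f)
          (extendPoint i₀ u (s - ∑ j, u j)) :=
      lintegral_lintegral_swap ((hp.mul hf).comp hE).aemeasurable
    _ = _ := lintegral_congr fun u => lintegral_sub_right_eq_self (fun v => ((fun x : ι → ℝ =>
        ENNReal.ofReal (∏ i, gammaPos (α i) r (x i))) * f) (extendPoint i₀ u v)) _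

end ExtendPoint

/-! ### Factorization of a symmetric function from products over translates. -/

section Factorization

variable {K : Finset ℤ}

/-- The agents from which some site of `J` can be reached by a jump in `K`. -/
def sources (K J : Finset ℤ) : Finset ℤ := (J ×ˢ K).image fun p => p.1 - p.2

lemma mem_sources {J : Finset ℤ} {i : ℤ} {k : ℤ} (hk : k ∈ K) (h : i + k ∈ J) :
    i ∈ sources K J :=
  Finset.mem_image.2 ⟨(i + k, k), by simp [hk, h], by simp⟩

/-- Each site of `J` is reached exactly once by each jump `k`; agents whose jump misses `J`
contribute `f 0 = 1`. -/
lemma prod_sources_prod {f : ℝ → ℝ} (hf : f 0 = 1) (J : Finset ℤ) (θ : ℤ → ℝ)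
    (hθ : ∀ j, j ∉ J → θ j = 0) :
    ∏ i ∈ sources K J, ∏ k : K, f (θ (i + k)) = ∏ j ∈ J, f (θ j) ^ K.card := by
  rw [Finset.prod_comm]
  have h : ∀ k : K, ∏ i ∈ sources K J, f (θ (i + k)) = ∏ j ∈ J, f (θ j) := by
    intro k
    have hinj : Set.InjOn (fun j : ℤ => j - (k : ℤ)) (J : Set ℤ) := fun a _ b _ hab => by
      simpa using hab
    have himg : ∏ i ∈ J.image (fun j : ℤ => j - (k : ℤ)), f (θ (i + k)) = ∏ j ∈ J, f (θ j) := by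
      rw [Finset.prod_image hinj]
      simp
    rw [← himg]
    symm
    refine Finset.prod_subset ?_ ?_
    · intro i hi
      obtain ⟨j, hj, rfl⟩ := Finset.mem_image.1 hi
      exact mem_sources k.2 (by simpa using hj)
    · intro i _ hi
      rw [hθ, hf]
      intro hJ
      exact hi (Finset.mem_image.2 ⟨i + k, hJ, by simp⟩)
  simp_rw [h]
  simp [Finset.prod_pow]

lemma exists_perm_of_card_support_eq {ι : Type*} [Fintype ι] [DecidableEq ι] {u t : ι → ℝ}
    (g : {k // u k ≠ 0} → {k // t k ≠ 0}) (hg : Function.Injective g)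
    (hgt : ∀ k, t (g k) = u k)
    (hcard : Fintype.card {k // u k ≠ 0} = Fintype.card {k // t k ≠ 0}) :
    ∃ s : Equiv.Perm ι, u = t ∘ s := by
  have hb : Function.Bijective g := (Fintype.bijective_iff_injective_and_card g).2 ⟨hg, hcard⟩
  let e := Equiv.ofBijective g hb
  refine ⟨e.extendSubtype, funext fun k => ?_⟩
  by_cases hk : u k ≠ 0
  · rw [Function.comp_apply, e.extendSubtype_apply_of_mem k hk]
    exact (hgt ⟨k, hk⟩).symm
  · have := e.extendSubtype_not_mem k hk
    push Not at hk this
    rw [Function.comp_apply, hk, this]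

/-- If the product of a positive symmetric function over the translates of a finitely supported
sequence factorizes over the sites, then the function itself factorizes. -/
theorem eq_prod_of_prod_sources_eq (hK : K.Nonempty) {Φ : (K → ℝ) → ℝ} {φ : ℝ → ℝ}
    (hpos : ∀ t, (∀ k, 0 ≤ t k) → 0 < Φ t) (hzero : Φ 0 = 1)
    (hsymm : ∀ (s : Equiv.Perm K) (t : K → ℝ), (∀ k, 0 ≤ t k) → Φ (t ∘ s) = Φ t)
    (hprod : ∀ (J : Finset ℤ) (θ : ℤ → ℝ), (∀ j, 0 ≤ θ j) → (∀ j, j ∉ J → θ j = 0) →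
      ∏ i ∈ sources K J, Φ (fun k => θ (i + k)) = ∏ j ∈ J, φ (θ j)) :
    ∃ f : ℝ → ℝ, f 0 = 1 ∧ (∀ x, 0 ≤ x → φ x = f x ^ K.card) ∧
      ∀ t : K → ℝ, (∀ k, 0 ≤ t k) → Φ t = ∏ k, f (t k) := by
  classical
  obtain ⟨k₀, hk₀⟩ := hK
  -- The only possible factor is Φ on a coordinate axis; by symmetry the axis is immaterial.
  let f : ℝ → ℝ := fun x => Φ (Pi.single ⟨k₀, hk₀⟩ x)
  have hsingle : ∀ {x : ℝ}, 0 ≤ x → ∀ k k' : K, 0 ≤ (Pi.single k x : K → ℝ) k' := by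
    intro x hx k k'
    rw [Pi.single_apply]
    split_ifs
    exacts [hx, le_rfl]
  have hf0 : f 0 = 1 := by simp [f, hzero]
  have hfpos : ∀ x, 0 ≤ x → 0 < f x := fun x hx => hpos _ (hsingle hx _)
  have hfk : ∀ x, 0 ≤ x → ∀ k : K, Φ (Pi.single k x) = f x := by
    intro x hx k
    rw [← hsymm (Equiv.swap k ⟨k₀, hk₀⟩) _ (hsingle hx k)]
    congr 1
    ext k'
    simp only [Function.comp_apply, Pi.single_apply]
    congr 1
    rw [Equiv.swap_apply_eq_iff, Equiv.swap_apply_left]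
  have hφ : ∀ x, 0 ≤ x → φ x = f x ^ K.card := by
    intro x hx
    -- With θ supported at the site 0, the agent `-k` sees `x` in coordinate `k` and zeros
    -- elsewhere.
    have h := hprod {0} (Pi.single 0 x) (fun j => by
      rw [Pi.single_apply]
      split_ifs
      exacts [hx, le_rfl]) (fun j hj => by
      rw [Pi.single_apply, if_neg (by simpa using hj)])
    rw [Finset.prod_singleton, Pi.single_eq_same] at h
    have hsrc : sources K {0} = K.image fun k => -k := by
      ext i
      simp [sources]
    rw [← h, hsrc, Finset.prod_image]
    · rw [← Finset.prod_const, ← Finset.prod_coe_sort K, ← Finset.prod_coe_sort K]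
      refine Finset.prod_congr rfl fun k _ => ?_
      rw [← hfk x hx k]
      congr 1
      ext k'
      simp only [Pi.single_apply, neg_add_eq_zero, Subtype.ext_iff]
      simp only [eq_comm]
    · intro a _ b _ hab
      simpa using hab
  refine ⟨f, hf0, hφ, ?_⟩
  -- Strong induction on the size of the support of `t`.
  suffices H : ∀ m : ℕ, ∀ t : K → ℝ, (∀ k, 0 ≤ t k) → Fintype.card {k // t k ≠ 0} = m →
      Φ t = ∏ k, f (t k) from fun t ht => H _ t ht rfl
  intro m
  induction m using Nat.strong_induction_on with
  | _ m ih =>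
  intro t ht hm
  -- Planted on `K`, the vector `t` is seen in full by the agent 0.
  let θ : ℤ → ℝ := fun j => if h : j ∈ K then t ⟨j, h⟩ else 0
  have hθ0 : ∀ j, 0 ≤ θ j := fun j => by
    simp only [θ]
    split_ifs
    exacts [ht _, le_rfl]
  have hθK : ∀ j, j ∉ K → θ j = 0 := fun j hj => by simp [θ, hj]
  have hθt : (fun k : K => θ (0 + k)) = t := by ext k; simp [θ]
  -- A window that misses part of the support falls under the induction hypothesis; one that
  -- contains it all sees a permutation of `t`.
  have hall : ∀ i : ℤ, Φ (fun k => θ (i + k)) = ∏ k : K, f (θ (i + k)) ∨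
      (Φ (fun k => θ (i + k)) = Φ t ∧ ∏ k : K, f (θ (i + k)) = ∏ k, f (t k)) := by
    intro i
    have hmemK : ∀ k : K, θ (i + k) ≠ 0 → i + k ∈ K := fun k hk => by
      by_contra h
      exact hk (hθK _ h)
    let g : {k : K // θ (i + k) ≠ 0} → {k // t k ≠ 0} := fun k =>
      ⟨⟨i + k, hmemK k.1 k.2⟩, by
        have := k.2
        simpa only [θ, hmemK k.1 k.2, dite_true] using this⟩
    have hg : Function.Injective g := by
      intro a b hab
      have : i + (a : ℤ) = i + (b : ℤ) := congrArg (fun z => ((z.1 : K) : ℤ)) hab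
      exact Subtype.ext (Subtype.ext (by simpa using this))
    have hgt : ∀ k, t (g k) = θ (i + k) := fun k => by
      simp only [θ, g, hmemK k.1 k.2, dite_true]
    rcases (Fintype.card_le_of_injective g hg).lt_or_eq with hlt | heq
    · exact Or.inl (ih _ (hm ▸ hlt) (fun k : K => θ (i + k)) (fun k => hθ0 _) rfl)
    · obtain ⟨s, hs⟩ := exists_perm_of_card_support_eq (u := fun k : K => θ (i + k)) g hg hgt heq
      refine Or.inr ⟨by rw [hs, hsymm s t ht], ?_⟩
      have : ∀ k : K, θ (i + k) = t (s k) := fun k => congrFun hs k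
      simp_rw [this]
      exact Equiv.prod_comp s fun k => f (t k)
  have heq : ∏ i ∈ sources K K, Φ (fun k => θ (i + k)) =
      ∏ i ∈ sources K K, ∏ k : K, f (θ (i + k)) := by
    rw [hprod K θ hθ0 hθK, prod_sources_prod hf0 K θ hθK]
    exact Finset.prod_congr rfl fun j _ => hφ _ (hθ0 j)
  have h0 : (0 : ℤ) ∈ sources K K := mem_sources hk₀ (by simpa using hk₀)
  have hΨpos : ∀ i, 0 < ∏ k : K, f (θ (i + k)) := fun i =>
    Finset.prod_pos fun k _ => hfpos _ (hθ0 _)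
  have hΦpos : ∀ i : ℤ, 0 < Φ (fun k => θ (i + k)) := fun i => hpos _ fun k => hθ0 _
  have hΨt : ∏ k : K, f (θ (0 + k)) = ∏ k, f (t k) :=
    Finset.prod_congr rfl fun k _ => by rw [← congrFun hθt k]
  -- By `hall`, every factor is either exact or errs just as the factor of agent 0 does. A strict
  -- inequality there would pass to the products of positive factors, against `heq`.
  rcases lt_trichotomy (Φ t) (∏ k, f (t k)) with hlt | h | hlt
  · refine absurd heq (ne_of_lt (Finset.prod_lt_prod (fun i _ => hΦpos i) (fun i _ => ?_)
      ⟨0, h0, ?_⟩))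
    · rcases hall i with h | ⟨h1, h2⟩
      · exact h.le
      · rw [h1, h2]; exact hlt.le
    · rw [hθt, hΨt]; exact hlt
  · exact h
  · refine absurd heq (ne_of_gt (Finset.prod_lt_prod (fun i _ => hΨpos i) (fun i _ => ?_)
      ⟨0, h0, ?_⟩))
    · rcases hall i with h | ⟨h1, h2⟩
      · exact h.ge
      · rw [h1, h2]; exact hlt.le
    · rw [hθt, hΨt]; exact hlt

end Factorization

/-! ### The differential equation characterizing Gamma laws. -/

section Lukacs

open Filter Topology

lemma exists_const_of_hasDerivAt_zero {f : ℝ → ℝ} (h : ∀ t < 0, HasDerivAt f 0 t) :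
    ∃ c, ∀ t < 0, f t = c := by
  obtain ⟨c, hc⟩ := isOpen_Iio.exists_is_const_of_fderiv_eq_zero (𝕜 := ℝ) (s := Set.Iio (0 : ℝ))
    isPreconnected_Iio (f := f) (fun t ht => (h t ht).differentiableAt.differentiableWithinAt)
    (fun t ht => by
      have := (h t ht).hasFDerivAt.fderiv
      simpa using this)
  exact ⟨c, hc⟩

variable {ν : Measure ℝ} [IsProbabilityMeasure ν]

lemma Iic_subset_integrableExpSet (hν : ∀ᵐ x ∂ν, 0 ≤ x) :
    Set.Iic 0 ⊆ integrableExpSet id ν := by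
  intro t ht
  refine Integrable.of_bound (C := 1) (by fun_prop) ?_
  filter_upwards [hν] with x hx
  rw [Real.norm_eq_abs, Real.abs_exp, Real.exp_le_one_iff]
  exact mul_nonpos_of_nonpos_of_nonneg ht hx

/-- Being interior is what allows differentiating the mgf under the integral sign at every `t < 0`.
-/
lemma mem_interior_integrableExpSet (hν : ∀ᵐ x ∂ν, 0 ≤ x) {t : ℝ} (ht : t < 0) :
    t ∈ interior (integrableExpSet id ν) :=
  mem_interior.2 ⟨Set.Iio 0, Set.Iio_subset_Iic_self.trans (Iic_subset_integrableExpSet hν),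
    isOpen_Iio, ht⟩

/-- The equation is solved on `t < 0` only; this limit fixes the constants of integration. -/
lemma tendsto_mgf_zero (hν : ∀ᵐ x ∂ν, 0 ≤ x) : Tendsto (mgf id ν) (𝓝[<] 0) (𝓝 1) := by
  have h1 : (1 : ℝ) = ∫ _, 1 ∂ν := by simp
  rw [h1]
  refine tendsto_integral_filter_of_dominated_convergence (fun _ => 1) ?_ ?_
    (integrable_const _) ?_
  · exact Eventually.of_forall fun t => by fun_prop
  · filter_upwards [self_mem_nhdsWithin] with t ht
    filter_upwards [hν] with x hx
    rw [Real.norm_eq_abs, Real.abs_exp, Real.exp_le_one_iff]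
    exact mul_nonpos_of_nonpos_of_nonneg (le_of_lt ht) hx
  · refine ae_of_all _ fun x => ?_
    have : Tendsto (fun t : ℝ => Real.exp (t * x)) (𝓝 0) (𝓝 (Real.exp (0 * x))) :=
      Continuous.tendsto (by fun_prop) 0
    rw [zero_mul, Real.exp_zero] at this
    exact this.mono_left nhdsWithin_le_nhds

lemma measure_eq_of_mgf_eq {μ : Measure ℝ} [IsProbabilityMeasure μ] (hν : ∀ᵐ x ∂ν, 0 ≤ x)
    (hμ : ∀ᵐ x ∂μ, 0 ≤ x)
    (h : ∀ t < 0, mgf id ν t = ∫ x, Real.exp (-(-t * x)) ∂μ) : ν = μ := by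
  refine measure_eq_of_integral_exp_neg_eq hν hμ fun t ht => ?_
  rcases ht.eq_or_lt with rfl | ht
  · simp
  · have := h (-t) (by linarith)
    simpa [mgf] using this

/-- A law on the half-line whose moment generating function `F` satisfies `F'' F = q F' ^ 2` is
either degenerate or a Gamma distribution. -/
theorem exists_eq_gammaMeasure_of_ode (hν : ∀ᵐ x ∂ν, 0 ≤ x) (hc : ∀ c, ν ≠ Measure.dirac c)
    {A B : ℝ} (hAB : A ≠ 0 ∨ B ≠ 0)
    (hode : ∀ t < 0, A * ((∫ x, x ^ 2 * Real.exp (t * x) ∂ν) * ∫ x, Real.exp (t * x) ∂ν) =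
      B * (∫ x, x * Real.exp (t * x) ∂ν) ^ 2) :
    ∃ α γ : ℝ, 0 < α ∧ 0 < γ ∧ ν = gammaMeasure α γ := by
  let F : ℝ → ℝ := mgf id ν
  let F₁ : ℝ → ℝ := fun t => ∫ x, x * Real.exp (t * x) ∂ν
  let F₂ : ℝ → ℝ := fun t => ∫ x, x ^ 2 * Real.exp (t * x) ∂ν
  have hF : ∀ t < 0, HasDerivAt F (F₁ t) t := fun t ht =>
    hasDerivAt_mgf (mem_interior_integrableExpSet hν ht)
  have hF₁ : ∀ t < 0, HasDerivAt F₁ (F₂ t) t := fun t ht => by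
    simpa using hasDerivAt_integral_pow_mul_exp_real (mem_interior_integrableExpSet hν ht) 1
  have hFpos : ∀ t < 0, 0 < F t := fun t ht =>
    mgf_pos (Iic_subset_integrableExpSet hν (le_of_lt ht))
  have hF₁pos : ∀ t < 0, 0 < F₁ t := by
    intro t ht
    have hnn : 0 ≤ᵐ[ν] fun x => x * Real.exp (t * x) := by
      filter_upwards [hν] with x hx using mul_nonneg hx (Real.exp_pos _).le
    refine lt_of_le_of_ne (integral_nonneg_of_ae hnn) fun h0 => hc 0 ?_
    have hint : Integrable (fun x => x * Real.exp (t * x)) ν := by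
      simpa using integrable_pow_mul_exp_of_mem_interior_integrableExpSet
        (mem_interior_integrableExpSet hν ht) 1
    have hz := (integral_eq_zero_iff_of_nonneg_ae hnn hint).1 h0.symm
    have hz' : (id : ℝ → ℝ) =ᵐ[ν] fun _ => 0 := by
      filter_upwards [hz] with x hx
      simpa [(Real.exp_pos (t * x)).ne'] using hx
    have : ν.map id = ν.map fun _ => 0 := Measure.map_congr hz'
    simpa using this
  have hode' : ∀ t < 0, A * (F₂ t * F t) = B * F₁ t ^ 2 := hode
  have hA : A ≠ 0 := by
    intro hA
    have h := hode' (-1) (by norm_num)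
    rw [hA, zero_mul] at h
    have hB := hAB.resolve_left (not_not.2 hA)
    exact (mul_ne_zero hB (pow_pos (hF₁pos (-1) (by norm_num)) 2).ne') h.symm
  -- With F''F = (b + 1)F'², the derivative of F/F' is -b, so F/F' = D - bt. Eventually 1/b is the
  -- shape and D/b the rate.
  set b : ℝ := B / A - 1 with hb
  have hode2 : ∀ t < 0, F₂ t * F t = (b + 1) * F₁ t ^ 2 := by
    intro t ht
    have := hode' t ht
    rw [hb]
    field_simp
    linarith
  obtain ⟨D, hD⟩ : ∃ D, ∀ t < 0, F t / F₁ t + b * t = D := by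
    refine exists_const_of_hasDerivAt_zero fun t ht => ?_
    have h := ((hF t ht).div (hF₁ t ht) (hF₁pos t ht).ne').add ((hasDerivAt_id t).const_mul b)
    convert! h using 1
    have h1 := hode2 t ht
    have h2 := (hF₁pos t ht).ne'
    field_simp
    linarith
  have hDF : ∀ t < 0, F t = (D - b * t) * F₁ t := by
    intro t ht
    have h2 := (hF₁pos t ht).ne'
    rw [← hD t ht]
    field_simp
    ring
  have hDpos : ∀ t < 0, 0 < D - b * t := by
    intro t ht
    have := hFpos t ht
    rw [hDF t ht] at this
    exact (pos_iff_pos_of_mul_pos this).2 (hF₁pos t ht)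
  rcases lt_trichotomy b 0 with hb0 | hb0 | hb0
  -- For b < 0 the positive quantity D - bt would be nonpositive at `min (-1) (D / b)`.
  · exfalso
    have h := hDpos (min (-1) (D / b)) (lt_of_le_of_lt (min_le_left _ _) (by norm_num))
    have h2 : D ≤ b * min (-1) (D / b) := by
      have := mul_le_mul_of_nonpos_left (min_le_right (-1) (D / b)) hb0.le
      rwa [mul_div_cancel₀ _ hb0.ne] at this
    linarith
  -- For b = 0, F'/F = 1/D gives F(t) = exp(t/D), the point mass at 1/D.
  · exfalso
    have hD0 : 0 < D := by simpa [hb0] using hDpos (-1) (by norm_num)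
    obtain ⟨C, hC⟩ : ∃ C, ∀ t < 0, F t * Real.exp (-(t / D)) = C := by
      refine exists_const_of_hasDerivAt_zero fun t ht => ?_
      have h := (hF t ht).mul ((hasDerivAt_id t).div_const D).neg.exp
      convert! h using 1
      rw [hDF t ht, hb0]
      simp only [id]
      field_simp
      ring
    have hlim : Tendsto (fun t => F t * Real.exp (-(t / D))) (𝓝[<] 0) (𝓝 (1 * 1)) := by
      refine (tendsto_mgf_zero hν).mul ?_
      have : Tendsto (fun t : ℝ => Real.exp (-(t / D))) (𝓝 0) (𝓝 (Real.exp (-(0 / D)))) :=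
        Continuous.tendsto (by fun_prop) 0
      rw [zero_div, neg_zero, Real.exp_zero] at this
      exact this.mono_left nhdsWithin_le_nhds
    have hC1 : C = 1 := by
      have h2 : Tendsto (fun t => F t * Real.exp (-(t / D))) (𝓝[<] 0) (𝓝 C) :=
        tendsto_const_nhds.congr' (by
          filter_upwards [self_mem_nhdsWithin] with t ht using (hC t ht).symm)
      simpa using tendsto_nhds_unique h2 hlim
    refine hc D⁻¹ (measure_eq_of_mgf_eq hν ?_ fun t ht => ?_)
    · rw [ae_dirac_iff measurableSet_Ici]
      exact (inv_pos.2 hD0).le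
    · rw [integral_dirac]
      have := hC t ht
      rw [hC1, Real.exp_neg, mul_inv_eq_one₀ (Real.exp_pos _).ne'] at this
      change F t = _
      rw [this]
      congr 1
      rw [div_eq_mul_inv]
      ring
  -- For b > 0, F(t) = (D/(D - bt))^{1/b}, a Gamma transform.
  · have hD0 : 0 ≤ D := by
      have hl : Tendsto (fun t => D - b * t) (𝓝[<] 0) (𝓝 (D - b * 0)) :=
        (Continuous.tendsto (by fun_prop) 0).mono_left nhdsWithin_le_nhds
      rw [mul_zero, sub_zero] at hl
      refine ge_of_tendsto hl ?_
      filter_upwards [self_mem_nhdsWithin] with t ht using (hDpos t ht).le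
    obtain ⟨C, hC⟩ : ∃ C, ∀ t < 0, F t * (D - b * t) ^ (1 / b) = C := by
      refine exists_const_of_hasDerivAt_zero fun t ht => ?_
      have hlin : HasDerivAt (fun t => D - b * t) (-(b * 1)) t :=
        ((hasDerivAt_id t).const_mul b).const_sub D
      have h := (hF t ht).mul (hlin.rpow_const (p := 1 / b) (Or.inl (hDpos t ht).ne'))
      convert! h using 1
      rw [hDF t ht]
      have h3 : (D - b * t) ^ (1 / b) = (D - b * t) * (D - b * t) ^ (1 / b - 1) := by
        rw [Real.rpow_sub_one (hDpos t ht).ne']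
        field_simp [(hDpos t ht).ne']
      rw [h3]
      field_simp
      ring
    have hlim : Tendsto (fun t => F t * (D - b * t) ^ (1 / b)) (𝓝[<] 0)
        (𝓝 (1 * D ^ (1 / b))) := by
      refine (tendsto_mgf_zero hν).mul ?_
      have : Tendsto (fun t : ℝ => (D - b * t) ^ (1 / b)) (𝓝 0) (𝓝 ((D - b * 0) ^ (1 / b))) := by
        refine Continuous.tendsto ?_ 0
        exact (by fun_prop : Continuous fun t : ℝ => D - b * t).rpow_const
          fun t => Or.inr (by positivity)
      rw [mul_zero, sub_zero] at this
      exact this.mono_left nhdsWithin_le_nhds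
    have hC1 : C = D ^ (1 / b) := by
      have h2 : Tendsto (fun t => F t * (D - b * t) ^ (1 / b)) (𝓝[<] 0) (𝓝 C) :=
        tendsto_const_nhds.congr' (by
          filter_upwards [self_mem_nhdsWithin] with t ht using (hC t ht).symm)
      simpa using tendsto_nhds_unique h2 hlim
    -- If D were 0, the conserved product would be 0, though both of its factors are positive.
    have hDpos0 : 0 < D := by
      refine lt_of_le_of_ne hD0 fun h0 => ?_
      have h1 := hC (-1) (by norm_num)
      rw [hC1, ← h0, Real.zero_rpow (by positivity)] at h1
      have h2 := hDpos (-1) (by norm_num)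
      rw [← h0] at h2
      exact (mul_pos (hFpos (-1) (by norm_num)) (Real.rpow_pos_of_pos h2 (1 / b))).ne' h1
    have : IsProbabilityMeasure (gammaMeasure (1 / b) (D / b)) :=
      isProbabilityMeasure_gammaMeasure (by positivity) (by positivity)
    refine ⟨1 / b, D / b, by positivity, by positivity,
      measure_eq_of_mgf_eq hν (gammaMeasure_ae_nonneg _ _) fun t ht => ?_⟩
    rw [integral_exp_neg_gammaMeasure (by positivity) (by positivity) (by linarith)]
    have h1 := hC t ht
    have h2 := hDpos t ht
    have h3 : D / b / (D / b + -t) = D / (D - b * t) := by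
      have : D / b + -t ≠ 0 := by
        have : 0 < D / b := by positivity
        linarith
      rw [div_eq_div_iff this h2.ne']
      field_simp
      ring
    rw [h3, Real.div_rpow hD0 h2.le, eq_div_iff (Real.rpow_pos_of_pos h2 _).ne', ← hC1]
    exact h1

end Lukacs

/-! ### Splitting a random mass in independent random proportions. -/

section Mixture

open Filter Topology

variable {ι : Type*} [Fintype ι]

/-- The law of `s • y`, where `s` and `y` are independent with laws `μ` and `ρ`. -/
noncomputable def scaledLaw (μ : Measure ℝ) (ρ : Measure (ι → ℝ)) : Measure (ι → ℝ) :=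
  (μ.prod ρ).map fun p => p.1 • p.2

instance isProbabilityMeasure_scaledLaw (μ : Measure ℝ) (ρ : Measure (ι → ℝ))
    [IsProbabilityMeasure μ] [IsProbabilityMeasure ρ] :
    IsProbabilityMeasure (scaledLaw μ ρ) :=
  Measure.isProbabilityMeasure_map measurable_smul_pi.aemeasurable

lemma laplace_scaledLaw (μ : Measure ℝ) (ρ : Measure (ι → ℝ)) (t : ι → ℝ) :
    laplace (scaledLaw μ ρ) t = ∫ p, Real.exp (-∑ i, t i * (p.1 * p.2 i)) ∂(μ.prod ρ) := by
  rw [laplace, scaledLaw, integral_map measurable_smul_pi.aemeasurable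
    (measurable_exp_neg_sum t).aestronglyMeasurable]
  simp

lemma laplace_pi (ν : ι → Measure ℝ) [∀ i, IsProbabilityMeasure (ν i)] (t : ι → ℝ) :
    laplace (Measure.pi ν) t = ∏ i, ∫ x, Real.exp (-(t i * x)) ∂(ν i) := by
  rw [laplace, ← integral_fintype_prod_eq_prod]
  simp_rw [← Real.exp_sum, Finset.sum_neg_distrib]

lemma laplace_zero (ν : Measure (ι → ℝ)) [IsProbabilityMeasure ν] : laplace ν 0 = 1 := by
  simp [laplace]

lemma laplace_pos {ν : Measure (ι → ℝ)} [IsProbabilityMeasure ν]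
    (hν : ∀ᵐ x ∂ν, ∀ i, 0 ≤ x i) {t : ι → ℝ} (ht : ∀ i, 0 ≤ t i) : 0 < laplace ν t := by
  refine integral_exp_pos (Integrable.of_bound (C := 1)
    (measurable_exp_neg_sum t).aestronglyMeasurable ?_)
  filter_upwards [hν] with x hx
  rw [Real.norm_eq_abs, Real.abs_exp, Real.exp_le_one_iff, neg_nonpos]
  exact Finset.sum_nonneg fun i _ => mul_nonneg (ht i) (hx i)

lemma scaledLaw_ae_nonneg {μ : Measure ℝ} {ρ : Measure (ι → ℝ)} [SFinite μ] [SFinite ρ]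
    (hμ : ∀ᵐ s ∂μ, 0 ≤ s) (hρ : ∀ᵐ y ∂ρ, ∀ i, 0 ≤ y i) :
    ∀ᵐ x ∂(scaledLaw μ ρ), ∀ i, 0 ≤ x i := by
  rw [scaledLaw, ae_map_iff measurable_smul_pi.aemeasurable (measurableSet_orthant ι)]
  filter_upwards [Measure.quasiMeasurePreserving_fst.ae hμ,
    Measure.quasiMeasurePreserving_snd.ae hρ] with p h1 h2 i
  exact mul_nonneg h1 (h2 i)

variable {μ : Measure ℝ} {ρ : Measure (ι → ℝ)} [IsProbabilityMeasure μ] [IsProbabilityMeasure ρ]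

lemma laplace_scaledLaw_comp_perm (s : Equiv.Perm ι) (hs : ρ.map (fun y i => y (s i)) = ρ)
    (t : ι → ℝ) : laplace (scaledLaw μ ρ) (t ∘ s) = laplace (scaledLaw μ ρ) t := by
  have hmp : MeasurePreserving (fun y : ι → ℝ => fun i => y (s i)) ρ ρ := ⟨by fun_prop, hs⟩
  have h := ((MeasurePreserving.id μ).prod hmp)
  rw [laplace_scaledLaw, laplace_scaledLaw]
  have hg : Measurable fun p : ℝ × (ι → ℝ) => Real.exp (-∑ i, (t ∘ s) i * (p.1 * p.2 i)) :=
    by fun_prop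
  conv_lhs => rw [← h.map_eq]
  rw [integral_map h.measurable.aemeasurable hg.aestronglyMeasurable]
  refine integral_congr_ae (ae_of_all _ fun p => ?_)
  simp only [Prod.map_fst, Prod.map_snd, id, Function.comp_apply]
  rw [Equiv.sum_comp s fun i => t i * (p.1 * p.2 i)]

/-- The coordinates of `s • y` add up to `s`, and dividing by a positive total returns `y`. Thus the
law of the parts determines that of the proportions. -/
lemma map_normalize_scaledLaw (hμ : ∀ᵐ s ∂μ, 0 < s) (hρ : ∀ᵐ y ∂ρ, ∑ i, y i = 1) :
    (scaledLaw μ ρ).map (fun x => (∑ i, x i)⁻¹ • x) = ρ := by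
  have hn : Measurable fun x : ι → ℝ => (∑ i, x i)⁻¹ • x :=
    (Finset.measurable_fun_sum _ fun i _ => measurable_pi_apply i).inv.smul measurable_id
  rw [scaledLaw, Measure.map_map hn measurable_smul_pi]
  have : ((fun x : ι → ℝ => (∑ i, x i)⁻¹ • x) ∘ fun p : ℝ × (ι → ℝ) => p.1 • p.2) =ᵐ[μ.prod ρ]
      Prod.snd := by
    filter_upwards [Measure.quasiMeasurePreserving_fst.ae hμ,
      Measure.quasiMeasurePreserving_snd.ae hρ] with p h1 h2
    simp only [Function.comp_apply, Pi.smul_apply, smul_eq_mul, ← Finset.mul_sum, h2, mul_one,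
      smul_smul, inv_mul_cancel₀ h1.ne', one_smul]
  rw [Measure.map_congr this]
  exact Measure.snd_prod

/-- The parts add up to `s`, which is therefore a sum of i.i.d. variables. -/
lemma mgf_eq_pow_of_scaledLaw_eq_pi {ν : Measure ℝ} [IsProbabilityMeasure ν]
    (hρ : ∀ᵐ y ∂ρ, ∑ i, y i = 1) (h : scaledLaw μ ρ = Measure.pi fun _ => ν) (t : ℝ) :
    mgf id μ t = mgf id ν t ^ Fintype.card ι := by
  have h1 : ∫ x, Real.exp (t * ∑ i, x i) ∂(scaledLaw μ ρ) = mgf id μ t := by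
    rw [scaledLaw, integral_map measurable_smul_pi.aemeasurable
      (by exact Measurable.aestronglyMeasurable (by fun_prop))]
    have h2 : ∫ p, Real.exp (t * ∑ i, (p.1 • p.2) i) ∂(μ.prod ρ) =
        ∫ p : ℝ × (ι → ℝ), Real.exp (t * p.1) * 1 ∂(μ.prod ρ) := by
      refine integral_congr_ae ?_
      filter_upwards [Measure.quasiMeasurePreserving_snd.ae hρ] with p hp
      simp [← Finset.mul_sum, hp]
    rw [h2, integral_prod_mul (fun s => Real.exp (t * s)) (fun _ : ι → ℝ => (1 : ℝ))]
    simp [mgf]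
  rw [← h1, h, mgf, ← integral_fintype_prod_eq_pow]
  simp_rw [Finset.mul_sum, Real.exp_sum, id]

variable [DecidableEq ι]

lemma dirichletMeasure_ae_sum (i₀ : ι) (α : ι → ℝ) :
    ∀ᵐ y ∂(dirichletMeasure i₀ α), ∑ i, y i = 1 := by
  rw [dirichletMeasure, ae_map_iff (measurable_simplexPoint i₀).aemeasurable
    (measurableSet_eq_fun (by fun_prop) measurable_const)]
  refine ae_of_all _ fun y => ?_
  rw [simplexPoint_eq_extendPoint, sum_extendPoint]
  ring

lemma scaledLaw_gammaMeasure_dirichletMeasure (i₀ : ι) {α : ι → ℝ} (hα : ∀ i, 0 < α i)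
    {r : ℝ} (hr : 0 < r) :
    scaledLaw (gammaMeasure (∑ i, α i) r) (dirichletMeasure i₀ α) =
      Measure.pi fun i => gammaMeasure (α i) r :=
  map_smul_gammaMeasure_prod_dirichletMeasure i₀ hα hr

/-- Comparing total masses in the Gamma–Dirichlet identity replaces a computation of the Beta
integral. -/
lemma isProbabilityMeasure_dirichletMeasure (i₀ : ι) {α : ι → ℝ} (hα : ∀ i, 0 < α i) :
    IsProbabilityMeasure (dirichletMeasure i₀ α) := by
  have hA : 0 < ∑ i, α i := Finset.sum_pos (fun i _ => hα i) ⟨i₀, Finset.mem_univ i₀⟩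
  have h1 := isProbabilityMeasure_gammaMeasure hA one_pos
  have h2 := fun i => isProbabilityMeasure_gammaMeasure (hα i) one_pos
  have h := congrArg (fun m => m Set.univ)
    (scaledLaw_gammaMeasure_dirichletMeasure i₀ hα one_pos)
  refine ⟨?_⟩
  simpa [scaledLaw, Measure.map_apply measurable_smul_pi MeasurableSet.univ,
    ← Set.univ_prod_univ, Measure.prod_prod] using h

/-- If the law of `s • y` is that of independent Gamma variables with a common rate, and `y` lies
in the simplex, then `y` has a Dirichlet distribution. -/
lemma eq_dirichletMeasure_of_scaledLaw_eq (i₀ : ι) {α : ι → ℝ} (hα : ∀ i, 0 < α i)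
    {r : ℝ} (hr : 0 < r) (hμ : μ = gammaMeasure (∑ i, α i) r) (hρ : ∀ᵐ y ∂ρ, ∑ i, y i = 1)
    (h : scaledLaw μ ρ = Measure.pi fun i => gammaMeasure (α i) r) :
    ρ = dirichletMeasure i₀ α := by
  have := isProbabilityMeasure_dirichletMeasure i₀ hα
  have hμpos : ∀ᵐ s ∂μ, 0 < s := hμ ▸ gammaMeasure_ae_pos _ _
  rw [← map_normalize_scaledLaw hμpos hρ, h, ← scaledLaw_gammaMeasure_dirichletMeasure i₀ hα hr,
    ← hμ, map_normalize_scaledLaw hμpos (dirichletMeasure_ae_sum i₀ α)]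

/-- If the Laplace transform of `scaledLaw μ ρ` is a product of copies of one function, then
the coordinates are independent and identically distributed. -/
lemma scaledLaw_eq_pi (hμ : ∀ᵐ s ∂μ, 0 ≤ s) (hρ : ∀ᵐ y ∂ρ, ∀ i, 0 ≤ y i) (i₀ : ι) {f : ℝ → ℝ}
    (hf0 : f 0 = 1)
    (hf : ∀ t : ι → ℝ, (∀ i, 0 ≤ t i) → laplace (scaledLaw μ ρ) t = ∏ i, f (t i)) :
    scaledLaw μ ρ = Measure.pi fun _ => (scaledLaw μ ρ).map fun x => x i₀ := by
  have hm : Measurable fun x : ι → ℝ => x i₀ := measurable_pi_apply i₀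
  have hnn := scaledLaw_ae_nonneg hμ hρ
  have : IsProbabilityMeasure ((scaledLaw μ ρ).map fun x => x i₀) :=
    Measure.isProbabilityMeasure_map hm.aemeasurable
  have h1 : ∀ᵐ x ∂((scaledLaw μ ρ).map fun x => x i₀), 0 ≤ x := by
    rw [ae_map_iff hm.aemeasurable measurableSet_Ici]
    filter_upwards [hnn] with x hx using hx i₀
  refine measure_eq_of_laplace_eq hnn ?_ fun t ht => ?_
  · exact ae_all_iff.2 fun i => Measure.tendsto_eval_ae_ae.eventually h1
  · rw [hf t ht, laplace_pi]
    refine Finset.prod_congr rfl fun i _ => ?_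
    rw [integral_map hm.aemeasurable (by fun_prop)]
    -- On the axis of `i₀` the product reduces to one factor, so `f` is the Laplace transform of the
    -- marginal.
    have h := hf (Pi.single i₀ (t i)) fun j => by
      rw [Pi.single_apply]
      split_ifs
      exacts [ht i, le_rfl]
    rw [laplace] at h
    simp only [Pi.single_apply, apply_ite f, hf0, ite_mul, zero_mul, Finset.sum_ite_eq',
      Finset.prod_ite_eq', Finset.mem_univ, if_true] at h
    exact h.symm

/-- Both sides compute the expectation of x_{i₀}² exp(t ∑ x_i): once through x = s • y with `s`, `y`
independent, once through independent coordinates. -/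
lemma integral_sq_mul_exp_of_scaledLaw_eq_pi {ν : Measure ℝ} [IsProbabilityMeasure ν]
    (hρ : ∀ᵐ y ∂ρ, ∑ i, y i = 1) (h : scaledLaw μ ρ = Measure.pi fun _ => ν) (i₀ : ι) (t : ℝ) :
    (∫ s, s ^ 2 * Real.exp (t * s) ∂μ) * ∫ y, y i₀ ^ 2 ∂ρ =
      (∫ x, x ^ 2 * Real.exp (t * x) ∂ν) * mgf id ν t ^ (Fintype.card ι - 1) := by
  have h1 : ∫ x, x i₀ ^ 2 * Real.exp (t * ∑ i, x i) ∂(scaledLaw μ ρ) =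
      (∫ s, s ^ 2 * Real.exp (t * s) ∂μ) * ∫ y, y i₀ ^ 2 ∂ρ := by
    rw [scaledLaw, integral_map measurable_smul_pi.aemeasurable
      (by exact Measurable.aestronglyMeasurable (by fun_prop)), ← integral_prod_mul]
    refine integral_congr_ae ?_
    filter_upwards [Measure.quasiMeasurePreserving_snd.ae hρ] with p hp
    simp only [Pi.smul_apply, smul_eq_mul, ← Finset.mul_sum, hp, mul_one]
    ring
  have h2 : ∀ x : ι → ℝ, x i₀ ^ 2 * Real.exp (t * ∑ i, x i) =
      ∏ i, (if i = i₀ then x i ^ 2 else 1) * Real.exp (t * x i) := by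
    intro x
    rw [Finset.prod_mul_distrib, Finset.prod_ite_eq', if_pos (Finset.mem_univ _), Finset.mul_sum,
      Real.exp_sum]
  rw [← h1, h]
  simp_rw [h2]
  rw [integral_fintype_prod_eq_prod (fun i x => (if i = i₀ then x ^ 2 else 1) * Real.exp (t * x)),
    ← Finset.mul_prod_erase _ _ (Finset.mem_univ i₀)]
  congr 1
  · simp
  · rw [Finset.prod_congr rfl (g := fun _ => mgf id ν t), Finset.prod_const,
      Finset.card_erase_of_mem (Finset.mem_univ _), Finset.card_univ]
    intro i hi
    simp [Finset.ne_of_mem_erase hi, mgf]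

/-- Differentiate the power relation twice. Truncated exponents are harmless, as the coefficients
`n` and `n - 1` vanish there. -/
lemma integral_sq_mul_exp_of_mgf_eq_pow {ν : Measure ℝ} [IsProbabilityMeasure ν]
    (hμ : ∀ᵐ s ∂μ, 0 ≤ s) (hν : ∀ᵐ x ∂ν, 0 ≤ x) {n : ℕ}
    (h : ∀ t, mgf id μ t = mgf id ν t ^ n) {t : ℝ} (ht : t < 0) :
    ∫ s, s ^ 2 * Real.exp (t * s) ∂μ =
      n * ((n - 1 : ℕ) * mgf id ν t ^ (n - 2) * (∫ x, x * Real.exp (t * x) ∂ν) ^ 2 +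
        mgf id ν t ^ (n - 1) * ∫ x, x ^ 2 * Real.exp (t * x) ∂ν) := by
  have hF : ∀ {κ : Measure ℝ} [IsProbabilityMeasure κ], (∀ᵐ x ∂κ, 0 ≤ x) → ∀ u < 0,
      HasDerivAt (mgf id κ) (∫ x, x * Real.exp (u * x) ∂κ) u := fun hκ u hu =>
    hasDerivAt_mgf (mem_interior_integrableExpSet hκ hu)
  have hF₁ : ∀ {κ : Measure ℝ} [IsProbabilityMeasure κ], (∀ᵐ x ∂κ, 0 ≤ x) → ∀ u < 0,
      HasDerivAt (fun u => ∫ x, x * Real.exp (u * x) ∂κ) (∫ x, x ^ 2 * Real.exp (u * x) ∂κ) u :=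
    fun hκ u hu => by
      simpa using hasDerivAt_integral_pow_mul_exp_real (mem_interior_integrableExpSet hκ hu) 1
  have h1 : ∀ u < 0, ∫ s, s * Real.exp (u * s) ∂μ =
      n * mgf id ν u ^ (n - 1) * ∫ x, x * Real.exp (u * x) ∂ν := by
    intro u hu
    have hd := (hF hν u hu).fun_pow n
    have : (fun u => mgf id ν u ^ n) = mgf id μ := funext fun u => (h u).symm
    rw [this] at hd
    exact (hF hμ u hu).unique hd
  have hd := (((hF hν t ht).fun_pow (n - 1)).const_mul (n : ℝ)).fun_mul (hF₁ hν t ht)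
  have heq : (fun u => ∫ s, s * Real.exp (u * s) ∂μ) =ᶠ[𝓝 t]
      fun u => n * mgf id ν u ^ (n - 1) * ∫ x, x * Real.exp (u * x) ∂ν := by
    filter_upwards [isOpen_Iio.mem_nhds ht] with u hu using h1 u hu
  rw [(hF₁ hμ t ht).unique (hd.congr_of_eventuallyEq heq), Nat.sub_sub]
  ring

/-- A characterization of the Gamma and Dirichlet distributions in the manner of Lukacs: a
non-degenerate variable `s ≥ 0` is split in independent random proportions `y`; if the resulting
parts are independent and identically distributed, then `s` is Gamma and `y` symmetric Dirichlet. -/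
theorem exists_gamma_of_scaledLaw_eq_pi (hμ : ∀ᵐ s ∂μ, 0 ≤ s) (hμc : ∀ c, μ ≠ Measure.dirac c)
    (hρ : ∀ᵐ y ∂ρ, ∀ i, 0 ≤ y i) (hρ1 : ∀ᵐ y ∂ρ, ∑ i, y i = 1) (hcard : 2 ≤ Fintype.card ι)
    (i₀ : ι) {f : ℝ → ℝ} (hf0 : f 0 = 1)
    (hf : ∀ t : ι → ℝ, (∀ i, 0 ≤ t i) → laplace (scaledLaw μ ρ) t = ∏ i, f (t i)) :
    ∃ a r : ℝ, 0 < a ∧ 0 < r ∧ μ = gammaMeasure a r ∧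
      ρ = dirichletMeasure i₀ fun _ => a / Fintype.card ι := by
  have hn : (0 : ℝ) < Fintype.card ι := by exact_mod_cast (by omega : 0 < Fintype.card ι)
  have hpi := scaledLaw_eq_pi hμ hρ i₀ hf0 hf
  set ν : Measure ℝ := (scaledLaw μ ρ).map fun x => x i₀ with hνdef
  have hm : Measurable fun x : ι → ℝ => x i₀ := measurable_pi_apply i₀
  have : IsProbabilityMeasure ν := Measure.isProbabilityMeasure_map hm.aemeasurable
  have hν : ∀ᵐ x ∂ν, 0 ≤ x := by
    rw [hνdef, ae_map_iff hm.aemeasurable measurableSet_Ici]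
    filter_upwards [scaledLaw_ae_nonneg hμ hρ] with x hx using hx i₀
  have hmgf := mgf_eq_pow_of_scaledLaw_eq_pi hρ1 hpi
  have hνc : ∀ c, ν ≠ Measure.dirac c := by
    intro c hc
    have hc0 : 0 ≤ c := by
      rw [hc, ae_dirac_iff measurableSet_Ici] at hν
      exact hν
    refine hμc (Fintype.card ι * c) (measure_eq_of_mgf_eq hμ ?_ fun t _ => ?_)
    · rw [ae_dirac_iff measurableSet_Ici]
      exact mul_nonneg hn.le hc0
    · rw [hmgf, hc, mgf, integral_dirac, integral_dirac, ← Real.exp_nat_mul, id]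
      congr 1
      ring
  set c := ∫ y, y i₀ ^ 2 ∂ρ
  -- With n parts, eliminating the second derivative for μ gives n c((n-1)F^{n-2}F'² + F^{n-1}F'') =
  -- F^{n-1}F''; dividing by F^{n-2} yields these coefficients. If B = 0, then n ≥ 2 gives nc = 0,
  -- hence A = 1.
  obtain ⟨α, r, hα, hr, hνg⟩ := exists_eq_gammaMeasure_of_ode hν hνc
    (A := 1 - Fintype.card ι * c) (B := Fintype.card ι * c * (Fintype.card ι - 1 : ℕ))
    (by
      by_contra! hcon
      obtain ⟨h1, h2⟩ := hcon
      have h3 : ((Fintype.card ι - 1 : ℕ) : ℝ) ≠ 0 := by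
        exact_mod_cast (by omega : Fintype.card ι - 1 ≠ 0)
      rw [(mul_eq_zero.1 h2).resolve_right h3] at h1
      norm_num at h1)
    (by
      intro t ht
      have h1 := integral_sq_mul_exp_of_scaledLaw_eq_pi hρ1 hpi i₀ t
      rw [integral_sq_mul_exp_of_mgf_eq_pow hμ hν hmgf ht] at h1
      have hFpos : 0 < mgf id ν t := mgf_pos (Iic_subset_integrableExpSet hν ht.le)
      have h2 : mgf id ν t ^ (Fintype.card ι - 1) =
          mgf id ν t ^ (Fintype.card ι - 2) * mgf id ν t := by
        rw [← pow_succ]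
        congr 1
        omega
      rw [h2] at h1
      have h3 : ∫ x, Real.exp (t * x) ∂ν = mgf id ν t := rfl
      rw [h3]
      refine mul_left_cancel₀ (pow_pos hFpos (Fintype.card ι - 2)).ne' ?_
      linear_combination -h1)
  have hμg : μ = gammaMeasure (Fintype.card ι * α) r := by
    have := isProbabilityMeasure_gammaMeasure (mul_pos hn hα) hr
    refine measure_eq_of_mgf_eq hμ (gammaMeasure_ae_nonneg _ _) fun t ht => ?_
    have hgm := integral_exp_neg_gammaMeasure hα hr (s := -t) (by linarith)
    simp only [neg_mul, neg_neg] at hgm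
    rw [integral_exp_neg_gammaMeasure (mul_pos hn hα) hr (by linarith), hmgf, hνg, mgf]
    simp only [id]
    rw [hgm, ← Real.rpow_natCast, ← Real.rpow_mul
      (div_nonneg hr.le (by linarith)), mul_comm]
  refine ⟨Fintype.card ι * α, r, mul_pos hn hα, hr, hμg, ?_⟩
  rw [mul_div_cancel_left₀ _ hn.ne']
  refine eq_dirichletMeasure_of_scaledLaw_eq i₀ (fun _ => hα) hr ?_ hρ1 (hνg ▸ hpi)
  simpa using hμg

end Mixture

/-! ### Independent pairs, and the exchange as a finite sum. -/

/-- Independence within `X`, within `Y` and between the two makes the pairs `(X i, Y i)` i.i.d. with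
law `μ.prod ρ`. -/
lemma integral_prod_comp_of_indep {Ω ι α β : Type*} [MeasurableSpace Ω] [Fintype ι]
    [MeasurableSpace α] [MeasurableSpace β] {P : Measure Ω} [IsProbabilityMeasure P]
    {μ : Measure α} {ρ : Measure β} [IsProbabilityMeasure μ] [IsProbabilityMeasure ρ]
    {X : ι → Ω → α} {Y : ι → Ω → β} (hX : ∀ i, HasLaw (X i) μ P) (hY : ∀ i, HasLaw (Y i) ρ P)
    (hXi : iIndepFun X P) (hYi : iIndepFun Y P)
    (hXY : IndepFun (fun ω i => X i ω) (fun ω i => Y i ω) P)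
    {g : ι → α × β → ℝ} (hg : ∀ i, Measurable (g i)) :
    ∫ ω, ∏ i, g i (X i ω, Y i ω) ∂P = ∏ i, ∫ p, g i p ∂(μ.prod ρ) := by
  have h1 := hXY.hasLaw_prod (hXi.hasLaw_pi hX) (hYi.hasLaw_pi hY)
  have h2 := (measurePreserving_arrowProdEquivProdArrow α β ι (fun _ => μ) fun _ => ρ).symm
  have h3 := h2.comp_hasLaw h1
  have hm : Measurable fun x : ι → α × β => ∏ i, g i (x i) :=
    Finset.measurable_fun_prod _ fun i _ => (hg i).comp (measurable_pi_apply i)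
  rw [← integral_fintype_prod_eq_prod, ← h3.integral_comp hm.aestronglyMeasurable]
  rfl

lemma exchange_eq_sum {Ω : Type*} {τ : ℤ → Ω → ℝ} {M : ℤ → ℤ → Ω → ℝ}
    {K : Finset ℤ} {ω : Ω} (hM : ∀ i j, j - i ∉ K → M i j ω = 0) {J : Finset ℤ} {j : ℤ}
    (hj : j ∈ J) : exchange τ M j ω = ∑ i ∈ sources K J, τ i ω * M i j ω := by
  refine tsum_eq_sum fun i hi => ?_
  rw [hM i j, mul_zero]
  intro hk
  exact hi (mem_sources hk (by simpa using hj))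

/-- Regrouping by agent instead of by site: each term then involves only one agent's mass and row.
-/
lemma sum_mul_exchange {Ω : Type*} {τ : ℤ → Ω → ℝ} {M : ℤ → ℤ → Ω → ℝ}
    {K : Finset ℤ} {ω : Ω} (hM : ∀ i j, j - i ∉ K → M i j ω = 0) {J : Finset ℤ} {θ : ℤ → ℝ}
    (hθ : ∀ j, j ∉ J → θ j = 0) :
    ∑ j ∈ J, θ j * exchange τ M j ω =
      ∑ i ∈ sources K J, ∑ k : K, θ (i + k) * (τ i ω * M i (i + k) ω) := by
  rw [Finset.sum_congr rfl fun j hj => by rw [exchange_eq_sum hM hj, Finset.mul_sum],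
    Finset.sum_comm]
  refine Finset.sum_congr rfl fun i _ => ?_
  -- Both finite sums extend by zero to all of ℤ, where they differ by a translation by `i`.
  rw [Finset.sum_coe_sort K fun k => θ (i + k) * (τ i ω * M i (i + k) ω),
    ← tsum_eq_sum (L := .unconditional ℤ) (f := fun j => θ j * (τ i ω * M i j ω)) (s := J)
      fun j hj => by rw [hθ j hj, zero_mul],
    ← tsum_eq_sum (L := .unconditional ℤ) (f := fun k => θ (i + k) * (τ i ω * M i (i + k) ω))
      (s := K) fun k hk => by rw [hM i (i + k) (by simpa using hk), mul_zero, mul_zero]]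
  exact ((Equiv.addLeft i).tsum_eq fun j => θ j * (τ i ω * M i j ω)).symm

/-! ### The exchanged masses and their joint Laplace transform. -/

section Exchange

variable {Ω Ω' : Type*} [MeasurableSpace Ω] [MeasurableSpace Ω'] {P : Measure Ω} {P' : Measure Ω'}
  {τ : ℤ → Ω → ℝ} {M : ℤ → ℤ → Ω → ℝ} {π : ℤ → Ω' → ℝ} {K : Finset ℤ}

lemma ae_eq_zero_of_notMem (hB1 : CondB1 P M P' π) (hK : ∀ i, i ∈ K ↔ 0 < P' {ω | 0 < π i ω}) :
    ∀ᵐ ω ∂P', ∀ k, k ∉ K → π k ω = 0 := by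
  rw [ae_all_iff]
  intro k
  by_cases hk : k ∈ K
  · simp [hk]
  · have h0 : ∀ᵐ ω ∂P', ¬ 0 < π k ω := by
      rw [ae_iff]
      simpa using mt (hK k).2 hk
    filter_upwards [h0, hB1.nonneg] with ω h1 h2 _
    exact le_antisymm (not_lt.1 h1) (h2 k)

lemma ae_sum_eq_one (hB1 : CondB1 P M P' π) (hK : ∀ i, i ∈ K ↔ 0 < P' {ω | 0 < π i ω}) :
    ∀ᵐ ω ∂P', ∑ k : K, π k ω = 1 := by
  filter_upwards [ae_eq_zero_of_notMem hB1 hK, hB1.hasSum_one] with ω h1 h2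
  rw [Finset.sum_coe_sort K fun k => π k ω]
  exact (hasSum_sum_of_ne_finset_zero fun k hk => h1 k hk).unique h2

lemma ae_matrix_eq_zero (hB1 : CondB1 P M P' π)
    (hK : ∀ i, i ∈ K ↔ 0 < P' {ω | 0 < π i ω}) :
    ∀ᵐ ω ∂P, ∀ i j, j - i ∉ K → M i j ω = 0 := by
  rw [ae_all_iff]
  intro i
  have hm : MeasurableSet {x : ℤ → ℝ | ∀ k, k ∉ K → x k = 0} := by
    rw [Set.ofPred_forall]
    refine MeasurableSet.iInter fun k => ?_
    by_cases hk : k ∈ K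
    · simp [hk]
    · simpa [hk] using measurableSet_eq_fun (measurable_pi_apply k) measurable_const
  filter_upwards [(hB1.ident i).symm.ae_snd hm (ae_eq_zero_of_notMem hB1 hK)] with ω h j hj
  simpa using h (j - i) hj

lemma ae_matrix_nonneg (hB1 : CondB1 P M P' π) : ∀ᵐ ω ∂P, ∀ i j, 0 ≤ M i j ω := by
  rw [ae_all_iff]
  intro i
  filter_upwards [(hB1.ident i).symm.ae_snd (measurableSet_orthant ℤ) hB1.nonneg] with ω h j
  simpa using h (j - i)

lemma exchange_ae_nonneg (hA1 : CondA1 P τ) (hB1 : CondB1 P M P' π) (j : ℤ) :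
    ∀ᵐ ω ∂P, 0 ≤ exchange τ M j ω := by
  filter_upwards [ae_all_iff.2 hA1.nonneg, ae_matrix_nonneg hB1] with ω h1 h2
  exact tsum_nonneg fun i => mul_nonneg (h1 i) (h2 i j)

lemma aemeasurable_matrix (hB1 : CondB1 P M P' π) (i j : ℤ) : AEMeasurable (M i j) P := by
  simpa using aemeasurable_pi_iff.1 (hB1.ident i).aemeasurable_fst (j - i)

lemma aemeasurable_exchange (hA1 : CondA1 P τ) (hB1 : CondB1 P M P' π)
    (hK : ∀ i, i ∈ K ↔ 0 < P' {ω | 0 < π i ω}) :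
    AEMeasurable (fun ω j => exchange τ M j ω) P := by
  refine aemeasurable_pi_iff.2 fun j => ?_
  have h : AEMeasurable (fun ω => ∑ i ∈ sources K {j}, τ i ω * M i j ω) P :=
    Finset.aemeasurable_fun_sum _ fun i _ =>
      (hA1.ident i).aemeasurable_fst.mul (aemeasurable_matrix hB1 i j)
  refine h.congr ?_
  filter_upwards [ae_matrix_eq_zero hB1 hK] with ω hM
  exact (exchange_eq_sum hM (Finset.mem_singleton_self j)).symm

variable [IsProbabilityMeasure P] [IsProbabilityMeasure P']

lemma integral_exp_neg_masses (hA1 : CondA1 P τ) (J : Finset ℤ) (θ : ℤ → ℝ) :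
    ∫ ω, Real.exp (-∑ j ∈ J, θ j * τ j ω) ∂P =
      ∏ j ∈ J, ∫ x, Real.exp (-(θ j * x)) ∂(P.map (τ 0)) := by
  have hm : ∀ j, AEMeasurable (τ j) P := fun j => (hA1.ident j).aemeasurable_fst
  have hprob : IsProbabilityMeasure (P.map (τ 0)) := Measure.isProbabilityMeasure_map (hm 0)
  have hlaw : ∀ j : J, HasLaw (τ j) (P.map (τ 0)) P := fun j => ⟨hm j, (hA1.ident j).map_eq⟩
  have hind : iIndepFun (fun j : J => τ j) P := hA1.indep.precomp Subtype.val_injective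
  have h := (hind.hasLaw_pi hlaw).integral_comp (f := fun x : J → ℝ =>
    Real.exp (-∑ j : J, θ j * x j)) (measurable_exp_neg_sum fun j : J => θ j).aestronglyMeasurable
  have h2 := laplace_pi (fun _ : J => P.map (τ 0)) fun j => θ j
  rw [laplace, ← h] at h2
  rw [← Finset.prod_coe_sort J, ← h2]
  refine integral_congr_ae (ae_of_all _ fun ω => ?_)
  simp only [Function.comp_apply]
  rw [Finset.sum_coe_sort J fun j => θ j * τ j ω]

/-- The joint Laplace transform of the masses after one exchange. -/
lemma integral_exp_neg_exchange (hA1 : CondA1 P τ) (hB1 : CondB1 P M P' π)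
    (hτM : IndepFun (fun ω i => τ i ω) (fun ω i j => M i j ω) P)
    (hK : ∀ i, i ∈ K ↔ 0 < P' {ω | 0 < π i ω}) {J : Finset ℤ} {θ : ℤ → ℝ}
    (hθ : ∀ j, j ∉ J → θ j = 0) :
    ∫ ω, Real.exp (-∑ j ∈ J, θ j * exchange τ M j ω) ∂P =
      ∏ i ∈ sources K J, laplace (scaledLaw (P.map (τ 0)) (P'.map fun ω (k : K) => π k ω))
        fun k => θ (i + k) := by
  have hm : ∀ j, AEMeasurable (τ j) P := fun j => (hA1.ident j).aemeasurable_fst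
  have hres : Measurable fun (x : ℤ → ℝ) (k : K) => x k := by fun_prop
  have hident : ∀ i, IdentDistrib (fun ω (k : K) => M i (i + k) ω) (fun ω (k : K) => π k ω) P P' :=
    fun i => (hB1.ident i).comp hres
  have hprob : IsProbabilityMeasure (P.map (τ 0)) := Measure.isProbabilityMeasure_map (hm 0)
  have hprob' : IsProbabilityMeasure (P'.map fun ω (k : K) => π k ω) :=
    Measure.isProbabilityMeasure_map (hident 0).aemeasurable_snd
  have hXY : IndepFun (fun ω (i : sources K J) => τ i ω)
      (fun ω (i : sources K J) (k : K) => M i (i + k) ω) P :=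
    hτM.comp (φ := fun (x : ℤ → ℝ) (i : sources K J) => x i)
      (ψ := fun (x : ℤ → ℤ → ℝ) (i : sources K J) (k : K) => x i (i + k))
      (by fun_prop) (by fun_prop)
  have key := integral_prod_comp_of_indep (P := P) (ι := sources K J)
    (X := fun i => τ i) (Y := fun i ω (k : K) => M i (i + k) ω)
    (fun i => ⟨hm i, (hA1.ident i).map_eq⟩)
    (fun i => ⟨(hident i).aemeasurable_fst, (hident i).map_eq⟩)
    (hA1.indep.precomp Subtype.val_injective)
    ((hB1.indep.comp _ fun _ => hres).precomp Subtype.val_injective) hXY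
    (g := fun i p => Real.exp (-∑ k : K, θ (i + k) * (p.1 * p.2 k))) (fun i => by fun_prop)
  simp_rw [laplace_scaledLaw]
  rw [← Finset.prod_coe_sort (sources K J), ← key]
  refine integral_congr_ae ?_
  filter_upwards [ae_matrix_eq_zero hB1 hK] with ω hM
  rw [sum_mul_exchange hM hθ, ← Real.exp_sum, Finset.sum_neg_distrib,
    ← Finset.sum_coe_sort (sources K J)]

end Exchange

end MassExchange

/-! ### The characterization of the invariant laws. -/

open MassExchange in
theorem theorem3 {Ω Ω' : Type*} [MeasurableSpace Ω] [MeasurableSpace Ω']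
    (P : Measure Ω) [IsProbabilityMeasure P] (P' : Measure Ω') [IsProbabilityMeasure P']
    (τ : ℤ → Ω → ℝ) (M : ℤ → ℤ → Ω → ℝ) (π : ℤ → Ω' → ℝ)
    (hA1 : MassExchange.CondA1 P τ) (hA2 : MassExchange.CondA2 P τ)
    (hB1 : MassExchange.CondB1 P M P' π)
    (hτM : IndepFun (fun ω i => τ i ω) (fun ω i j => M i j ω) P)
    (hτ : ∀ c : ℝ, ¬ (τ 0 =ᵐ[P] fun _ => c))
    (K : Finset ℤ) (hK : ∀ i, i ∈ K ↔ 0 < P' {ω | 0 < π i ω}) (hK2 : 2 ≤ K.card)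
    (hexch : ∀ S : Finset ℤ, S ⊆ K → MassExchange.IsExchangeable P' (fun i : S => π i)) :
    IdentDistrib (fun ω j => MassExchange.exchange τ M j ω) (fun ω j => τ j ω) P P ↔
      ∃ a γ : ℝ, 0 < a ∧ 0 < γ ∧ (∀ j, HasLaw (τ j) (gammaMeasure a γ) P) ∧
        MassExchange.IsDirichlet P' (fun i : K => π i) (fun _ => a / (K.card : ℝ)) := by
  have hm : ∀ j, AEMeasurable (τ j) P := fun j => (hA1.ident j).aemeasurable_fst
  have hmπ : AEMeasurable (fun ω (k : K) => π k ω) P' :=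
    ((hB1.ident 0).comp (u := fun (x : ℤ → ℝ) (k : K) => x k) (by fun_prop)).aemeasurable_snd
  have hmτ : AEMeasurable (fun ω j => τ j ω) P := aemeasurable_pi_iff.2 hm
  have hmS := aemeasurable_exchange hA1 hB1 hK
  set μ := P.map (τ 0) with hμdef
  set ρ := P'.map fun ω (k : K) => π k ω with hρdef
  have hμprob : IsProbabilityMeasure μ := Measure.isProbabilityMeasure_map (hm 0)
  have hρprob : IsProbabilityMeasure ρ := Measure.isProbabilityMeasure_map hmπ
  have hμ0 : ∀ᵐ s ∂μ, 0 ≤ s := (ae_map_iff (hm 0) measurableSet_Ici).2 (hA1.nonneg 0)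
  have hρ0 : ∀ᵐ y ∂ρ, ∀ k, 0 ≤ y k := by
    rw [hρdef, ae_map_iff hmπ (measurableSet_orthant K)]
    filter_upwards [hB1.nonneg] with ω h k using h k
  have hρ1 : ∀ᵐ y ∂ρ, ∑ k, y k = 1 := by
    rw [hρdef, ae_map_iff hmπ (measurableSet_eq_fun (by fun_prop) measurable_const)]
    exact ae_sum_eq_one hB1 hK
  have hne : K.Nonempty := Finset.card_pos.1 (by omega)
  obtain ⟨k₀, hk₀⟩ := hne
  have hcard : Fintype.card K = K.card := Fintype.card_coe K
  constructor
  · intro hid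
    have hprod : ∀ (J : Finset ℤ) (θ : ℤ → ℝ), (∀ j, 0 ≤ θ j) → (∀ j, j ∉ J → θ j = 0) →
        ∏ i ∈ sources K J, laplace (scaledLaw μ ρ) (fun k => θ (i + k)) =
          ∏ j ∈ J, ∫ x, Real.exp (-(θ j * x)) ∂μ := by
      intro J θ _ hθ
      rw [← integral_exp_neg_exchange hA1 hB1 hτM hK hθ, ← integral_exp_neg_masses hA1]
      exact (hid.comp (u := fun x : ℤ → ℝ => Real.exp (-∑ j ∈ J, θ j * x j))
        (by fun_prop)).integral_eq
    have hsymm : ∀ (s : Equiv.Perm K) (t : K → ℝ), (∀ k, 0 ≤ t k) →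
        laplace (scaledLaw μ ρ) (t ∘ s) = laplace (scaledLaw μ ρ) t := by
      intro s t _
      refine laplace_scaledLaw_comp_perm s ?_ t
      rw [hρdef, AEMeasurable.map_map_of_aemeasurable
        (Measurable.aemeasurable (by fun_prop)) hmπ]
      exact (hexch K subset_rfl s).map_eq
    -- The relation of `f` to φ can be dropped: `mgf_eq_pow_of_scaledLaw_eq_pi` recovers it from the
    -- shares adding up to the mass.
    obtain ⟨f, hf0, -, hf⟩ := eq_prod_of_prod_sources_eq ⟨k₀, hk₀⟩
      (φ := fun x => ∫ y, Real.exp (-(x * y)) ∂μ)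
      (fun t ht => laplace_pos (scaledLaw_ae_nonneg hμ0 hρ0) ht) (laplace_zero _) hsymm hprod
    have hμc : ∀ c, μ ≠ Measure.dirac c := fun c hc =>
      hτ c ((⟨hm 0, hc⟩ : HasLaw (τ 0) (Measure.dirac c) P).ae_eq_of_dirac)
    obtain ⟨a, r, ha, hr, hμg, hρd⟩ := exists_gamma_of_scaledLaw_eq_pi hμ0 hμc hρ0 hρ1
      (hcard ▸ hK2) ⟨k₀, hk₀⟩ hf0 hf
    refine ⟨a, r, ha, hr, fun j => ⟨hm j, (hA1.ident j).map_eq.trans hμg⟩, fun _ => ?_,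
      ⟨k₀, hk₀⟩, hmπ, ?_⟩
    · exact div_pos ha (by exact_mod_cast (by omega : 0 < K.card))
    · rw [hcard] at hρd
      exact hρd
  · rintro ⟨a, r, ha, hr, hlaw, hα, i₀, hdir⟩
    have hn : (0 : ℝ) < K.card := by exact_mod_cast (by omega : 0 < K.card)
    have hμg : μ = gammaMeasure a r := (hlaw 0).map_eq
    have hsum : ∑ _k : K, a / (K.card : ℝ) = a := by
      simp [mul_div_cancel₀ _ hn.ne']
    have hν : scaledLaw μ ρ = Measure.pi fun _ : K => gammaMeasure (a / K.card) r := by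
      rw [← scaledLaw_gammaMeasure_dirichletMeasure i₀ hα hr, hsum, hμg]
      congr 1
      exact hdir.map_eq
    have hg := isProbabilityMeasure_gammaMeasure (hα i₀) hr
    refine ⟨hmS, hmτ, ?_⟩
    have h1 := Measure.isProbabilityMeasure_map hmS
    have h2 := Measure.isProbabilityMeasure_map hmτ
    have hhalf : ∀ j : ℤ, MeasurableSet {x : ℤ → ℝ | 0 ≤ x j} := fun j =>
      measurableSet_le measurable_const (measurable_pi_apply j)
    refine measure_eq_of_forall_laplace_eq
      (fun j => (ae_map_iff hmS (hhalf j)).2 (exchange_ae_nonneg hA1 hB1 j))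
      (fun j => (ae_map_iff hmτ (hhalf j)).2 (hA1.nonneg j)) fun J t ht => ?_
    -- Cut off outside `J`, so that windows reaching beyond `J` see zeros there.
    let θ : ℤ → ℝ := fun j => if j ∈ J then t j else 0
    have hθ : ∀ j, j ∉ J → θ j = 0 := fun j hj => if_neg hj
    have hθ0 : ∀ j, 0 ≤ θ j := fun j => by
      simp only [θ]
      split_ifs
      exacts [ht j, le_rfl]
    have hθt : ∀ x : ℤ → ℝ, ∑ j ∈ J, t j * x j = ∑ j ∈ J, θ j * x j := fun x =>
      Finset.sum_congr rfl fun j hj => by simp [θ, hj]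
    simp_rw [hθt]
    have hmexp : Measurable fun x : ℤ → ℝ => Real.exp (-∑ j ∈ J, θ j * x j) := by fun_prop
    rw [integral_map hmS hmexp.aestronglyMeasurable, integral_map hmτ hmexp.aestronglyMeasurable,
      integral_exp_neg_exchange hA1 hB1 hτM hK hθ, integral_exp_neg_masses hA1, ← hμdef, ← hρdef,
      hν]
    -- The Laplace transform of one share; regrouped by site it appears to the power |K|, which is
    -- the transform of Γ(a, r).
    let f : ℝ → ℝ := fun x => (r / (r + x)) ^ (a / (K.card : ℝ))
    have hf0 : f 0 = 1 := by simp [f, hr.ne']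
    have hl : ∀ i ∈ sources K J, laplace (Measure.pi fun _ : K => gammaMeasure (a / K.card) r)
        (fun k => θ (i + k)) = ∏ k : K, f (θ (i + k)) := fun i _ => by
      rw [laplace_pi]
      exact Finset.prod_congr rfl fun k _ => integral_exp_neg_gammaMeasure (hα i₀) hr (hθ0 _)
    rw [Finset.prod_congr rfl hl, prod_sources_prod hf0 J θ hθ]
    refine Finset.prod_congr rfl fun j _ => ?_
    rw [hμg, integral_exp_neg_gammaMeasure ha hr (hθ0 j), ← Real.rpow_natCast, ← Real.rpow_mul
      (div_nonneg hr.le (by linarith [hθ0 j])), div_mul_cancel₀ _ hn.ne']
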